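/- Let $K$ be a field of characteristic $0$ (for instance a subfield of $\mathbb{R}$), with algebraic closure $\overline K$, let $n\ge 1$, let $d\ge 2$ be an even integer, and let $f_1,\dots,f_m,g\in K[x_1,\dots,x_n]$ have degree at most $d$. Let $S\subset\{1,\dots,m\}$ with $s:=|S|\le n$, let $\sigma_i\in\{1,-1\}$ for $i\in S$, and put $D_s=\binom{n}{s}d^s(d-1)^{n-s}$. Let $q_0=n+1$, let $q_1<\dots<q_m$ be the first $m$ primes greater than $n+1$, let $a_{ij}=\frac{1}{q_i-j}$ for $0\le i\le m$, $0\le j\le n$, and let $T_d$ be the Chebyshev polynomial (of the first kind) of degree $d$. Put $$\tilde g=\sum_{j=1}^n a_{0j}T_d(x_j),\qquad \tilde f_i=a_{i0}+\sum_{j=1}^n a_{ij}\,(T_d(x_j)+1),$$ $$F_i=t f_i+\sigma_i(1-t)\tilde f_i\ \ (i\in S),\qquad G_j=t\,g_j+(1-t)\,\tilde g_j\ \ (1\le j\le n),$$ where $$g_j=\lambda_0\frac{\partial g}{\partial x_j}-\sum_{i\in S}\lambda_i\frac{\partial f_i}{\partial x_j},\qquad \tilde g_j=\lambda_0\frac{\partial\tilde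 g}{\partial x_j}-\sum_{i\in S}\lambda_i\sigma_i\frac{\partial\tilde f_i}{\partial x_j}.$$ Then the variety defined by the $F_i$ $(i\in S)$ and $G_1,\dots,G_n$ in $\mathbb{A}^n_{\overline{K(t)}}\times\mathbb{P}^s_{\overline{K(t)}}$, where $\mathbb{P}^s$ has the homogeneous coordinates $\lambda_0,(\lambda_i)_{i\in S}$, is zero-dimensional: it consists of exactly $D_s$ distinct points $W_1,\dots,W_{D_s}$. These all lie in $\{\lambda_0\ne 0\}$, and their projections to the $x$-space $\mathbb{A}^n$ are pairwise distinct. Moreover, these points can be considered as elements of $\overline K[[t]]^{n+s}$, lifted from $t=0$. That is, there are an embedding $\varphi$, over $K[t]$, of $\overline{K(t)}$ in an algebraic closure of $\overline K((t))$, and points $\mathcal W_1,\dots,\mathcal W_{D_s}\in\overline K[[t]]^{n+s}$, such that for every $k$ the map $\varphi$ sends the coordinates $\big(x_j,\lambda_i/\lambda_0\big)_{1\le j\le n,\ i\in S}$ of $W_k$ to those of $\mathcal W_k$. The $\mathcal W_k$ are exactly the zeros in $\overline K[[t]]^{n+s}$ of the system $F_i=0$ $(i\in S)$, $G_1=\dots=G_n=0$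 dehomogenized with $\lambda_0=1$, and $\mathcal W_k\mapsto\mathcal W_k(0)$ is a bijection from them to the zeros in $\overline K^{\,n+s}$ of the initial system $\sigma_i\tilde f_i=0$ $(i\in S)$, $\tilde g_1=\dots=\tilde g_n=0$ dehomogenized with $\lambda_0=1$. -/

import Mathlib

noncomputable section

namespace Deformation

open scoped Polynomial

/-- `q₀ = n + 1`, and `q₁ < q₂ < ⋯` are the prime numbers greater than `n + 1`, in order. -/
def q (n : ℕ) : ℕ → ℕ
  | 0 => n + 1
  | i + 1 => Nat.nth (fun p => p.Prime ∧ n + 1 < p) i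

/-- The entry `a_{ij} = 1 / (q_i - j)` of the Cauchy matrix, for `0 ≤ j ≤ n`. -/
def a (n i j : ℕ) : ℚ := 1 / ((q n i : ℚ) - (j : ℚ))

/-- The multihomogeneous Bezout number `D_s = binom(n, s) d^s (d - 1)^(n - s)`. -/
def bezoutNumber (n d s : ℕ) : ℕ := n.choose s * d ^ s * (d - 1) ^ (n - s)

section Polynomials

variable (K : Type*) [Field K] [CharZero K] (n d : ℕ)

/-- The Chebyshev polynomial `T_d` of the first kind in the variable `x_j`. -/
def cheb (j : Fin n) : MvPolynomial (Fin n) K :=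
  Polynomial.aeval (MvPolynomial.X j) (Polynomial.Chebyshev.T K (d : ℤ))

/-- `g̃ = ∑_j a_{0j} T_d(x_j)`; the coordinate `x_j` with `1 ≤ j ≤ n` is the one with the
zero-based index `j - 1`. -/
def gTilde : MvPolynomial (Fin n) K :=
  ∑ j : Fin n, MvPolynomial.C ((a n 0 (j.val + 1) : ℚ) : K) * cheb K n d j

/-- `f̃_i = a_{i0} + ∑_j a_{ij} (T_d(x_j) + 1)`, for `i ≥ 1`. -/
def fTilde (i : ℕ) : MvPolynomial (Fin n) K :=
  MvPolynomial.C ((a n i 0 : ℚ) : K) +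
    ∑ j : Fin n, MvPolynomial.C ((a n i (j.val + 1) : ℚ) : K) * (cheb K n d j + 1)

end Polynomials

section System

variable {K : Type*} [Field K] {n m : ℕ}

/-- For `p` and a family `h_i`, `i ∈ S`, of polynomials in `x`, the polynomial
`λ₀ ∂p/∂x_j - ∑_{i ∈ S} λ_i ∂h_i/∂x_j` in the variables `x` and `λ`. The variables `λ` are indexed
by `Option S`: the index `none` stands for `λ₀`, and `some i` for `λ_i`. -/
def lagrange (S : Finset (Fin m)) (p : MvPolynomial (Fin n) K) (h : S → MvPolynomial (Fin n) K)
    (j : Fin n) : MvPolynomial (Fin n ⊕ Option S) K :=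
  MvPolynomial.X (Sum.inr none) * MvPolynomial.rename Sum.inl (MvPolynomial.pderiv j p) -
    ∑ i : S, MvPolynomial.X (Sum.inr (some i)) *
      MvPolynomial.rename Sum.inl (MvPolynomial.pderiv j (h i))

/-- The deformation `t p + (1 - t) p̃`, a polynomial over `K[t]`. -/
def deform {ι : Type*} (p pTilde : MvPolynomial ι K) : MvPolynomial ι K[X] :=
  MvPolynomial.C Polynomial.X * MvPolynomial.map Polynomial.C p +
    MvPolynomial.C (1 - Polynomial.X) * MvPolynomial.map Polynomial.C pTilde

variable [CharZero K]

/-- The signed polynomials `σ_i f̃_i` for `i ∈ S`; the index `i ∈ {1, …, m}` is the element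
`i - 1` of `Fin m`. -/
def fTildeSigned (n d : ℕ) (S : Finset (Fin m)) (σ : S → ℤˣ) (i : S) : MvPolynomial (Fin n) K :=
  ((σ i : ℤ) : MvPolynomial (Fin n) K) * fTilde K n d (i.val.val + 1)

/-- `F_i^{σ_i} = t f_i + σ_i (1 - t) f̃_i`. -/
def F (d : ℕ) (f : Fin m → MvPolynomial (Fin n) K) (S : Finset (Fin m)) (σ : S → ℤˣ) (i : S) :
    MvPolynomial (Fin n) K[X] :=
  deform (f i.val) (fTildeSigned n d S σ i)

/-- The polynomial `g̃_j = λ₀ ∂g̃/∂x_j - ∑_{i ∈ S} λ_i ∂(σ_i f̃_i)/∂x_j`. -/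
def gTildeLagrange (d : ℕ) (S : Finset (Fin m)) (σ : S → ℤˣ) (j : Fin n) :
    MvPolynomial (Fin n ⊕ Option S) K :=
  lagrange S (gTilde K n d) (fTildeSigned n d S σ) j

/-- The polynomial `G_j = t g_j + (1 - t) g̃_j`, where
`g_j = λ₀ ∂g/∂x_j - ∑_{i ∈ S} λ_i ∂f_i/∂x_j`. -/
def G (d : ℕ) (f : Fin m → MvPolynomial (Fin n) K) (g : MvPolynomial (Fin n) K)
    (S : Finset (Fin m)) (σ : S → ℤˣ) (j : Fin n) : MvPolynomial (Fin n ⊕ Option S) K[X] :=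
  deform (lagrange S g (fun i => f i.val) j) (gTildeLagrange d S σ j)

/-- The algebraic set defined by the `F_i`, `i ∈ S`, and `G_1, …, G_n` in the product of the affine
`n`-space and the projective space with coordinates `λ₀, (λ_i)_{i ∈ S}` over an extension `Ω` of
the ring `K[t]`. Each `G_j` is homogeneous of degree one in `λ`, so the choice of a representative
of the projective point does not matter. -/
def variety (Ω : Type*) [Field Ω] (ρ : K[X] →+* Ω) (d : ℕ)
    (f : Fin m → MvPolynomial (Fin n) K) (g : MvPolynomial (Fin n) K)
    (S : Finset (Fin m)) (σ : S → ℤˣ) :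
    Set ((Fin n → Ω) × Projectivization Ω (Option S → Ω)) :=
  {P | (∀ i : S, MvPolynomial.eval₂ ρ P.1 (F d f S σ i) = 0) ∧
       ∀ j : Fin n, MvPolynomial.eval₂ ρ (Sum.elim P.1 P.2.rep) (G d f g S σ j) = 0}

/-- The vector of values of `λ` with `λ₀ = 1` and the given `λ_i`, `i ∈ S`. -/
def dehom {B : Type*} [One B] {S : Finset (Fin m)} (l : S → B) : Option S → B :=
  fun o => o.elim 1 l

/-- The zeros `(x, (λ_i)_{i ∈ S})` with coordinates in a ring `B` over `K[t]` of the deformed system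
dehomogenized with `λ₀ = 1`. -/
def affineZeros {B : Type*} [CommRing B] (ρ : K[X] →+* B) (d : ℕ)
    (f : Fin m → MvPolynomial (Fin n) K) (g : MvPolynomial (Fin n) K)
    (S : Finset (Fin m)) (σ : S → ℤˣ) : Set ((Fin n → B) × (S → B)) :=
  {P | (∀ i : S, MvPolynomial.eval₂ ρ P.1 (F d f S σ i) = 0) ∧
       ∀ j : Fin n, MvPolynomial.eval₂ ρ (Sum.elim P.1 (dehom P.2)) (G d f g S σ j) = 0}

/-- The zeros `(x, (λ_i)_{i ∈ S})` with coordinates in an extension `L` of `K` of the initial system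
`σ_i f̃_i`, `g̃_j`, dehomogenized with `λ₀ = 1`. -/
def initialZeros (L : Type*) [Field L] [Algebra K L] (n d : ℕ) (S : Finset (Fin m)) (σ : S → ℤˣ) :
    Set ((Fin n → L) × (S → L)) :=
  {P | (∀ i : S, MvPolynomial.aeval P.1 (fTildeSigned (K := K) n d S σ i) = 0) ∧
       ∀ j : Fin n,
         MvPolynomial.aeval (Sum.elim P.1 (dehom P.2)) (gTildeLagrange (K := K) d S σ j) = 0}

end System

section Fields

variable (K : Type*) [Field K]

/-- An algebraic closure of `K(t)`. -/
abbrev Omega : Type _ := AlgebraicClosure (RatFunc K)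

/-- The embedding of `K[t]` in the algebraic closure of `K(t)`. -/
def toOmega : K[X] →+* Omega K :=
  (algebraMap (RatFunc K) (Omega K)).comp (algebraMap K[X] (RatFunc K))

/-- The ring of formal power series over an algebraic closure of `K`. -/
abbrev Series : Type _ := PowerSeries (AlgebraicClosure K)

/-- The embedding of `K[t]` in the ring of power series over the algebraic closure of `K`. -/
def toSeries : K[X] →+* Series K :=
  (Polynomial.coeToPowerSeries.ringHom (R := AlgebraicClosure K)).comp
    (Polynomial.mapRingHom (algebraMap K (AlgebraicClosure K)))

/-- An algebraic closure of the field of formal Laurent series over an algebraic closure of `K`. -/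
abbrev BigField : Type _ := AlgebraicClosure (LaurentSeries (AlgebraicClosure K))

/-- The embedding of the power series ring in `BigField K`. -/
def seriesToBig : Series K →+* BigField K :=
  (algebraMap (LaurentSeries (AlgebraicClosure K)) (BigField K)).comp
    (HahnSeries.ofPowerSeries ℤ (AlgebraicClosure K))

/-- The value at `t = 0` of a point with power series coordinates. -/
def atZero {ι κ : Type*} (P : (ι → Series K) × (κ → Series K)) :
    (ι → AlgebraicClosure K) × (κ → AlgebraicClosure K) :=
  (fun j => PowerSeries.constantCoeff (P.1 j), fun i => PowerSeries.constantCoeff (P.2 i))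

end Fields

end Deformation

end

/-! At `t = 0` the system splits. In terms of `y_j = T_d(x_j) + 1` the `F_i` are, up to sign, affine
forms in `y`, and `G_j` is the product of a linear form `L_j(λ)` and `T_d'(x_j)`. The coefficients
of all these forms are, up to sign, entries of one Cauchy matrix. By Pell's equation `T_d = ±1` at
the critical points of `T_d`, that is, `y_j ∈ {0, 2}`.

Two bounds now meet. Square Cauchy matrices are invertible, so a nonzero `λ` annihilates at most `s`
of the `L_j`. A `p`-adic argument with the largest prime `q_i` involved (`combination_ne_zero`)
shows that a solution `y` of the affine equations has at least `s` coordinates outside `{0, 2}`;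
there `T_d'(x_j) ≠ 0`, so `L_j` must vanish. Hence at an initial zero exactly `s` of the `L_j`
vanish, and the other `n - s` coordinates of `x` are critical points (`initial_structure`). This
gives the number `D_s` of initial zeros (`natCard_affineZeros_initial`) and, because the critical
points of `T_d` are nondegenerate, the invertibility of the Jacobian there (`tangent_eq_zero`,
`det_jacobian_ne_zero`).

By Hensel's lemma each initial zero lifts to exactly one power series zero. Conversely, take any
zero in `𝔸ⁿ × ℙˢ` over the algebraic closure of the Laurent series field, and a valuation ring of
that field that dominates the power series ring. The leading forms of the initial system exclude
poles of `x` (`no_zero_at_infinity`), and `λ₀` cannot reduce to zero (`lambda_zero_ne_zero`). So the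
zero is integral (`exists_integral_zero`), it reduces to an initial zero, and uniqueness in Hensel's
lemma identifies it with a lift.

A finite zero set over an algebraically closed field does not grow under field extension
(`exists_map_eq_of_finite_zeros`). This is used twice: to descend reductions from the residue field
to the algebraic closure of `K`, and to descend power series zeros to the algebraic closure of
`K(t)`. -/

noncomputable section

namespace Deformation

open scoped Polynomial

/-! ### Cauchy matrices and Lagrange interpolation. -/

section Cauchy

variable {F : Type*} [Field F] {ι κ : Type*}

/-- A Cauchy matrix with at least as many rows as columns has trivial kernel. -/
lemma cauchy_injective (s : Finset ι) (t : Finset κ) (x : ι → F) (y : κ → F)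
    (hx : Set.InjOn x s) (hy : Set.InjOn y t) (hxy : ∀ i ∈ s, ∀ j ∈ t, x i ≠ y j)
    (hc : t.card ≤ s.card) (c : κ → F) (h : ∀ i ∈ s, ∑ j ∈ t, c j / (x i - y j) = 0) :
    ∀ j ∈ t, c j = 0 := by
  classical
  -- The numerator of the partial fraction sum `∑ c_j / (X - y_j)`: its degree is less than the
  -- number of its zeros `x_i`, and its value at `y_j` is a nonzero multiple of `c_j`.
  set P : F[X] := ∑ j ∈ t, Polynomial.C (c j) * Lagrange.nodal (t.erase j) y with hP
  have hdeg : P.degree < s.card := by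
    rcases t.eq_empty_or_nonempty with rfl | hne
    · simp only [hP, Finset.sum_empty, Polynomial.degree_zero]
      exact WithBot.bot_lt_coe _
    refine lt_of_lt_of_le ?_ (Nat.cast_le.mpr hc)
    refine (Polynomial.degree_sum_le _ _).trans_lt ?_
    rw [Finset.sup_lt_iff (WithBot.bot_lt_coe _)]
    intro j hj
    rw [← Polynomial.smul_eq_C_mul]
    refine (Polynomial.degree_smul_le _ _).trans_lt ?_
    rw [Lagrange.degree_nodal, Nat.cast_lt]
    exact Finset.card_erase_lt_of_mem hj
  have hev : ∀ i ∈ s, P.eval (x i) = 0 := by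
    intro i hi
    have : P.eval (x i) = (∏ j ∈ t, (x i - y j)) * ∑ j ∈ t, c j / (x i - y j) := by
      rw [hP, Polynomial.eval_finsetSum, Finset.mul_sum]
      refine Finset.sum_congr rfl fun j hj => ?_
      have hne := sub_ne_zero.mpr (hxy i hi j hj)
      rw [Polynomial.eval_mul, Polynomial.eval_C, Lagrange.eval_nodal,
        ← Finset.mul_prod_erase t _ hj]
      field_simp
    rw [this, h i hi, mul_zero]
  have hP0 := Polynomial.eq_zero_of_degree_lt_of_eval_index_eq_zero _ hx hdeg hev
  intro j hj
  have h1 : P.eval (y j) = c j * ∏ k ∈ t.erase j, (y j - y k) := by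
    rw [hP, Polynomial.eval_finsetSum, Finset.sum_eq_single j]
    · rw [Polynomial.eval_mul, Polynomial.eval_C, Lagrange.eval_nodal]
    · intro k _ hkj
      rw [Polynomial.eval_mul, Lagrange.eval_nodal_at_node, mul_zero]
      exact Finset.mem_erase.mpr ⟨hkj.symm, hj⟩
    · exact fun hn => (hn hj).elim
  rw [hP0, Polynomial.eval_zero] at h1
  refine (mul_eq_zero.mp h1.symm).resolve_right ?_
  refine Finset.prod_ne_zero_iff.mpr fun k hk => sub_ne_zero.mpr fun hjk => ?_
  exact (Finset.mem_erase.mp hk).1 (hy (Finset.mem_of_mem_erase hk) hj hjk.symm)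

/-- For nodes `x i` and a finset `t` with fewer elements than `s`, a vector that annihilates the
columns of the Cauchy matrix belonging to `t`, with its pairing with any other column. -/
lemma sum_nodalWeight_mul_nodal_div [DecidableEq ι] (s : Finset ι) (t : Finset κ) (x : ι → F)
    (y : κ → F) (hx : Set.InjOn x s) (hc : t.card < s.card) (z : F) (hz : ∀ i ∈ s, z ≠ x i) :
    ∑ i ∈ s, Lagrange.nodalWeight s x i * (∏ j ∈ t, (x i - y j)) * (1 / (x i - z)) =
      -((∏ j ∈ t, (z - y j)) / ∏ i ∈ s, (z - x i)) := by
  have hdeg : (Lagrange.nodal t y).degree < s.card := by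
    rw [Lagrange.degree_nodal]; exact_mod_cast hc
  -- Barycentric interpolation of `∏ (X - y_j)` at the nodes `x_i`, evaluated at `z`; the result
  -- vanishes when `z` is one of the `y_j`.
  have h := congrArg (Polynomial.eval z) (Lagrange.eq_interpolate hx hdeg)
  rw [Lagrange.eval_interpolate_not_at_node _ hz, Lagrange.eval_nodal, Lagrange.eval_nodal] at h
  have hne : ∏ i ∈ s, (z - x i) ≠ 0 :=
    Finset.prod_ne_zero_iff.mpr fun i hi => sub_ne_zero.mpr (hz i hi)
  rw [h, mul_div_cancel_left₀ _ hne, ← Finset.sum_neg_distrib]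
  refine Finset.sum_congr rfl fun i hi => ?_
  have h1 : z - x i ≠ 0 := sub_ne_zero.mpr (hz i hi)
  rw [Lagrange.eval_nodal, ← neg_sub z (x i), one_div, inv_neg]
  ring

end Cauchy

/-! ### The primes `q_i` and the `p`-adic nonvanishing argument. -/

section Primes

lemma infinite_primes_gt (n : ℕ) : (Set.ofPred fun p : ℕ => p.Prime ∧ n + 1 < p).Infinite := by
  refine Set.infinite_of_not_bddAbove fun ⟨b, hb⟩ => ?_
  obtain ⟨p, hp, hpp⟩ := Nat.exists_infinite_primes (b + n + 2)
  have := hb (show p ∈ Set.ofPred fun p : ℕ => p.Prime ∧ n + 1 < p from ⟨hpp, by omega⟩)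
  omega

lemma q_succ_prime (n i : ℕ) : (q n (i + 1)).Prime :=
  (Nat.nth_mem_of_infinite (infinite_primes_gt n) i).1

lemma lt_q_succ (n i : ℕ) : n + 1 < q n (i + 1) :=
  (Nat.nth_mem_of_infinite (infinite_primes_gt n) i).2

lemma q_strictMono (n : ℕ) : StrictMono (q n) := by
  refine strictMono_nat_of_lt_succ fun i => ?_
  cases i with
  | zero => exact lt_q_succ n 0
  | succ i => exact Nat.nth_strictMono (infinite_primes_gt n) (Nat.lt_succ_self i)

lemma lt_q (n i : ℕ) : n < q n i := by
  cases i with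
  | zero => exact Nat.lt_succ_self n
  | succ i => exact (Nat.lt_succ_self n).trans (lt_q_succ n i)

variable {L : Type*} [Field L] [CharZero L]

lemma cast_a (n i j : ℕ) : ((a n i j : ℚ) : L) = 1 / ((q n i : L) - (j : L)) := by
  simp [a]

lemma padicNorm_ratio_le {ι κ : Type*} (p : ℕ) [Fact p.Prime] (s : Finset ι) (t : Finset κ)
    (u : κ → ℤ) (v : ι → ℤ) (hv : ∀ i ∈ s, ¬ (p : ℤ) ∣ v i) :
    padicNorm p (-((∏ j ∈ t, (u j : ℚ)) / ∏ i ∈ s, (v i : ℚ))) ≤ 1 := by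
  have h1 : padicNorm p ((∏ i ∈ s, v i : ℤ) : ℚ) = 1 := by
    refine (padicNorm.int_eq_one_iff _).mpr fun h => ?_
    obtain ⟨i, hi, h⟩ := (Prime.dvd_finsetProd_iff
      (Nat.prime_iff_prime_int.mp (Fact.out : p.Prime)) _).mp h
    exact hv i hi h
  have h2 : padicNorm p ((∏ j ∈ t, u j : ℤ) : ℚ) ≤ 1 := padicNorm.of_int _
  push_cast at h1 h2
  rw [padicNorm.neg, padicNorm.div, h1, div_one]
  exact h2

/-- The rational number that has to be nonzero for the linear system `f̃_i = 0` to have no solution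
`y` with fewer than `#s` coordinates outside `{0, 2}`. -/
lemma combination_ne_zero (n : ℕ) {ι : Type*} [DecidableEq ι] (s : Finset ι) (r : ι → ℕ)
    (hr : Set.InjOn r s) (B J : Finset (Fin n)) (hB : B.card < s.card) :
    ∑ i ∈ s, Lagrange.nodalWeight s (fun i => (q n (r i + 1) : ℚ)) i *
        (∏ j ∈ B, ((q n (r i + 1) : ℚ) - ((j.val + 1 : ℕ) : ℚ))) *
        (a n (r i + 1) 0 + ∑ j ∈ J, a n (r i + 1) (j.val + 1) * 2) ≠ 0 := by
  intro h0
  set x : ι → ℚ := fun i => (q n (r i + 1) : ℚ) with hxdef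
  have hx : Set.InjOn x s := by
    intro i hi k hk hik
    have := (q_strictMono n).injective (Nat.cast_injective hik)
    exact hr hi hk (by omega)
  -- `Φ z` is the pairing of the weights with the column `z` of the Cauchy matrix.
  set Φ : ℕ → ℚ := fun z =>
    -((∏ j ∈ B, ((z : ℚ) - ((j.val + 1 : ℕ) : ℚ))) / ∏ i ∈ s, ((z : ℚ) - x i)) with hΦ
  have key : ∀ z : ℕ, z ≤ n → ∑ i ∈ s, Lagrange.nodalWeight s x i *
      (∏ j ∈ B, (x i - ((j.val + 1 : ℕ) : ℚ))) * a n (r i + 1) z = Φ z := by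
    intro z hz
    refine sum_nodalWeight_mul_nodal_div s B x (fun j => ((j.val + 1 : ℕ) : ℚ)) hx hB z ?_
    intro i _ h
    have := lt_q n (r i + 1)
    have h2 : z = q n (r i + 1) := Nat.cast_injective h
    omega
  have hsum : Φ 0 + ∑ j ∈ J, Φ (j.val + 1) * 2 = 0 := by
    rw [← h0, ← key 0 (Nat.zero_le _)]
    simp_rw [mul_add, Finset.sum_add_distrib, Finset.mul_sum]
    rw [Finset.sum_comm]
    congr 1
    refine Finset.sum_congr rfl fun j _ => ?_
    rw [← key _ j.isLt, Finset.sum_mul]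
    exact Finset.sum_congr rfl fun i _ => by ring
  -- Let `p` be the largest of the primes. For `1 ≤ j ≤ n` all `q_i - j` lie strictly between `0`
  -- and `p`, so `Φ j` is `p`-integral. The denominator of `Φ 0` is, up to sign, the product of the
  -- `q_i`, which contains `p`, and its numerator is prime to `p`. So `Φ 0` cannot cancel against
  -- the other terms.
  obtain ⟨i₀, hi₀, hmax⟩ := Finset.exists_max_image s r
    (Finset.card_pos.mp (lt_of_le_of_lt (Nat.zero_le _) hB))
  set p := q n (r i₀ + 1) with hp
  have : Fact p.Prime := ⟨q_succ_prime n _⟩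
  have hle : ∀ i ∈ s, q n (r i + 1) ≤ p := fun i hi =>
    (q_strictMono n).monotone (Nat.succ_le_succ (hmax i hi))
  have hint : ∀ j ∈ J, padicNorm p (Φ (j.val + 1) * 2) ≤ 1 := by
    intro j _
    rw [padicNorm.mul]
    refine mul_le_one₀ ?_ (padicNorm.nonneg _) (by exact_mod_cast padicNorm.of_nat (p := p) 2)
    have := padicNorm_ratio_le p s B (fun k => (j.val + 1 : ℤ) - (k.val + 1 : ℤ))
      (fun i => (j.val + 1 : ℤ) - (q n (r i + 1) : ℤ)) (by
        intro i hi hdvd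
        have h1 := hle i hi
        have h2 := lt_q n (r i + 1)
        have h3 := j.isLt
        have h4 : (p : ℤ) ∣ (q n (r i + 1) : ℤ) - (j.val + 1 : ℤ) := by
          rw [← dvd_neg, neg_sub]; exact hdvd
        have := Int.le_of_dvd (by omega) h4
        omega)
    push_cast at this
    simpa [hΦ, hxdef] using this
  have h1 : padicNorm p (Φ 0) ≤ 1 := by
    rw [eq_neg_of_add_eq_zero_left hsum, padicNorm.neg]
    exact padicNorm.sum_le' hint zero_le_one
  have hnum : padicNorm p (∏ j ∈ B, ((j.val + 1 : ℕ) : ℚ)) = 1 := by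
    rw [← Nat.cast_prod, padicNorm.nat_eq_one_iff]
    intro hdvd
    obtain ⟨j, _, hj⟩ := (Prime.dvd_finsetProd_iff
      (Nat.prime_iff.mp (Fact.out : p.Prime)) _).mp hdvd
    have h2 := lt_q n (r i₀ + 1)
    have := Nat.le_of_dvd (Nat.succ_pos _) hj
    have := j.isLt
    omega
  have hmulp : Φ 0 * ((∏ i ∈ s.erase i₀, (0 - x i)) * (p : ℚ)) =
      ∏ j ∈ B, ((0 : ℚ) - ((j.val + 1 : ℕ) : ℚ)) := by
    have hne : ∏ i ∈ s, ((0 : ℚ) - x i) ≠ 0 := by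
      refine Finset.prod_ne_zero_iff.mpr fun i _ => ?_
      rw [zero_sub, neg_ne_zero]
      exact Nat.cast_ne_zero.mpr (q_succ_prime n _).ne_zero
    have h3 : (∏ i ∈ s, ((0 : ℚ) - x i)) = -((∏ i ∈ s.erase i₀, (0 - x i)) * (p : ℚ)) := by
      rw [← Finset.mul_prod_erase s _ hi₀, zero_sub]
      ring
    simp only [hΦ, Nat.cast_zero]
    rw [h3] at hne ⊢
    rw [div_neg, neg_neg, div_mul_cancel₀ _ (neg_ne_zero.mp hne)]
  have h4 := congrArg (padicNorm p) hmulp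
  rw [padicNorm.mul, padicNorm.mul, padicNorm.padicNorm_p_of_prime] at h4
  have h5 : padicNorm p (∏ j ∈ B, ((0 : ℚ) - ((j.val + 1 : ℕ) : ℚ))) = 1 := by
    simp_rw [zero_sub]
    rw [Finset.prod_neg, padicNorm.mul, hnum, mul_one]
    rcases neg_one_pow_eq_or ℚ B.card with h | h <;> simp [h]
  have h6 : padicNorm p (∏ i ∈ s.erase i₀, (0 - x i)) ≤ 1 := by
    have := padicNorm.of_int (p := p) (∏ i ∈ s.erase i₀, (0 - (q n (r i + 1) : ℤ)))
    push_cast at this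
    exact this
  have hp2 : (1 : ℚ) < p := by exact_mod_cast (Fact.out : p.Prime).one_lt
  rw [h5] at h4
  have h7 : padicNorm p (∏ i ∈ s.erase i₀, (0 - x i)) * (p : ℚ)⁻¹ < 1 :=
    lt_of_le_of_lt (mul_le_of_le_one_left (by positivity) h6) (inv_lt_one_of_one_lt₀ hp2)
  have h8 := mul_le_mul h1 h7.le (mul_nonneg (padicNorm.nonneg _) (by positivity)) zero_le_one
  nlinarith [padicNorm.nonneg (p := p) (Φ 0),
    mul_nonneg (padicNorm.nonneg (p := p) (∏ i ∈ s.erase i₀, (0 - x i)))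
      (show (0 : ℚ) ≤ (p : ℚ)⁻¹ by positivity)]

end Primes

/-! ### Critical points and level sets of the Chebyshev polynomials. -/

section ChebyshevRoots

open Polynomial

/-- Pell's equation for the Chebyshev polynomials in terms of the derivative of `T_d`. -/
lemma chebyshev_pell (L : Type*) [Field L] [CharZero L] (d : ℕ) :
    (1 - X ^ 2) * derivative (Chebyshev.T L d) ^ 2 + (d : L[X]) ^ 2 * Chebyshev.T L d ^ 2 =
      (d : L[X]) ^ 2 := by
  set T := Chebyshev.T L d with hT
  have hode := Chebyshev.one_sub_X_sq_mul_derivative_derivative_T_eq_poly_in_T (R := L) (d : ℤ)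
  rw [Function.iterate_succ, Function.iterate_one, Function.comp_apply, ← hT] at hode
  push_cast at hode
  set E : L[X] := (1 - X ^ 2) * derivative T ^ 2 + (d : L[X]) ^ 2 * T ^ 2 - (d : L[X]) ^ 2 with hE
  -- `E'` is `2 T'` times the Chebyshev differential equation, so `E` is constant; its value at `1`
  -- is zero because `T(1) = 1`.
  have hder : derivative E = 0 := by
    simp only [hE, derivative_add, derivative_sub, derivative_mul, derivative_pow, derivative_one,
      derivative_X, derivative_natCast, map_natCast]
    push_cast
    linear_combination 2 * derivative T * hode
  have hconst := eq_C_of_natDegree_eq_zero (derivative_eq_zero.mp hder)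
  have h1 : E.eval 1 = 0 := by
    simp [hE, hT, Chebyshev.T_eval_one]
  rw [hconst, eval_C] at h1
  rw [h1, C_0] at hconst
  exact sub_eq_zero.mp hconst

lemma natCard_roots {L : Type*} [Field L] [IsAlgClosed L] (p : L[X]) (hp : p ≠ 0)
    (h : ∀ x, p.eval x = 0 → (derivative p).eval x ≠ 0) :
    Nat.card {x : L // p.eval x = 0} = p.natDegree := by
  classical
  have hnd : p.roots.Nodup := by
    rw [Multiset.nodup_iff_count_le_one]
    intro x
    rw [count_roots]
    by_contra! hlt
    have := (one_lt_rootMultiplicity_iff_isRoot hp).mp hlt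
    exact h x this.1 this.2
  rw [← IsAlgClosed.card_roots_eq_natDegree, ← Multiset.toFinset_card_of_nodup hnd,
    ← Nat.card_eq_finsetCard]
  exact Nat.card_congr (Equiv.subtypeEquivRight fun x => by simp [hp])

variable {L : Type*} [Field L] [CharZero L] {d : ℕ}

/-- At a critical point Pell's equation reduces to `d² T² = d²`. -/
lemma chebyshev_T_eval_of_critical (hd : 0 < d) {x : L}
    (hx : (derivative (Chebyshev.T L d)).eval x = 0) :
    (Chebyshev.T L d).eval x = 1 ∨ (Chebyshev.T L d).eval x = -1 := by
  have h := congrArg (eval x) (chebyshev_pell L d)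
  simp only [eval_add, eval_mul, eval_pow, hx, eval_natCast] at h
  have hd' : (d : L) ^ 2 ≠ 0 := pow_ne_zero _ (Nat.cast_ne_zero.mpr hd.ne')
  have h2 : (Chebyshev.T L d).eval x ^ 2 = 1 := mul_left_cancel₀ hd' (by linear_combination h)
  exact sq_eq_one_iff.mp h2

/-- If `T'` and `T''` both vanished at `x`, the differential equation would give `d² T(x) = 0`,
against `T(x) = ±1`. -/
lemma chebyshev_second_derivative_ne_zero (hd : 0 < d) {x : L}
    (hx : (derivative (Chebyshev.T L d)).eval x = 0) :
    (derivative (derivative (Chebyshev.T L d))).eval x ≠ 0 := by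
  intro h2
  have hode := congrArg (eval x)
    (Chebyshev.one_sub_X_sq_mul_derivative_derivative_T_eq_poly_in_T (R := L) (d : ℤ))
  rw [Function.iterate_succ, Function.iterate_one, Function.comp_apply] at hode
  simp only [eval_sub, eval_mul, eval_pow, hx, h2, Int.cast_natCast, eval_natCast, mul_zero,
    zero_sub, zero_eq_neg] at hode
  have hd' : (d : L) ^ 2 ≠ 0 := pow_ne_zero _ (Nat.cast_ne_zero.mpr hd.ne')
  have h0 := (mul_eq_zero.mp hode).resolve_left hd'
  rcases chebyshev_T_eval_of_critical hd hx with h | h <;> simp [h] at h0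

lemma natDegree_chebyshev_T (d : ℕ) : (Chebyshev.T L d).natDegree = d := by
  rw [Chebyshev.natDegree_T, Int.natAbs_natCast]

lemma natCard_critical [IsAlgClosed L] (hd : 0 < d) :
    Nat.card {x : L // (derivative (Chebyshev.T L d)).eval x = 0} = d - 1 := by
  have hnd : (derivative (Chebyshev.T L d)).natDegree = d - 1 := by
    rw [natDegree_derivative, natDegree_chebyshev_T]
  rw [natCard_roots _ ?_ fun x => chebyshev_second_derivative_ne_zero hd, hnd]
  intro h0
  have := derivative_eq_zero.mp h0
  rw [natDegree_chebyshev_T] at this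
  omega

/-- The only critical values of `T + 1` are `0` and `2`, so any other level consists of simple
roots. -/
lemma natCard_level [IsAlgClosed L] (hd : 0 < d) {y : L} (h0 : y ≠ 0) (h2 : y ≠ 2) :
    Nat.card {x : L // (Chebyshev.T L d).eval x + 1 = y} = d := by
  have hdeg : (Chebyshev.T L d + C (1 - y)).natDegree = d := by
    rw [natDegree_add_C, natDegree_chebyshev_T]
  have := natCard_roots (Chebyshev.T L d + C (1 - y)) ?_ ?_
  · rw [hdeg] at this
    refine Eq.trans (Nat.card_congr (Equiv.subtypeEquivRight fun x => by
      rw [eval_add, eval_C, ← sub_eq_zero, add_sub_assoc])) this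
  · intro h
    rw [h, natDegree_zero] at hdeg
    omega
  · intro x hx hx'
    rw [derivative_add, derivative_C, add_zero] at hx'
    rw [eval_add, eval_C] at hx
    rcases chebyshev_T_eval_of_critical hd hx' with h | h
    · exact h2 (by linear_combination h - hx)
    · exact h0 (by linear_combination h - hx)

end ChebyshevRoots

/-! ### Values of the system over an arbitrary ring. -/

section Evaluation

variable {K : Type*} [Field K] {n m : ℕ} {B : Type*} [CommRing B]

lemma eval₂_deform {ι : Type*} (ρ : K[X] →+* B) (x : ι → B) (p p' : MvPolynomial ι K) :
    MvPolynomial.eval₂ ρ x (deform p p') =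
      ρ Polynomial.X * MvPolynomial.eval₂ (ρ.comp Polynomial.C) x p +
        (1 - ρ Polynomial.X) * MvPolynomial.eval₂ (ρ.comp Polynomial.C) x p' := by
  simp [deform, MvPolynomial.eval₂_map]

lemma eval₂_lagrange (c : K →+* B) (S : Finset (Fin m)) (p : MvPolynomial (Fin n) K)
    (h : S → MvPolynomial (Fin n) K) (j : Fin n) (x : Fin n → B) (l : Option S → B) :
    MvPolynomial.eval₂ c (Sum.elim x l) (lagrange S p h j) =
      l none * MvPolynomial.eval₂ c x (MvPolynomial.pderiv j p) -
        ∑ i : S, l (some i) * MvPolynomial.eval₂ c x (MvPolynomial.pderiv j (h i)) := by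
  simp only [lagrange, MvPolynomial.eval₂_sub, MvPolynomial.eval₂_mul, MvPolynomial.eval₂_X,
    MvPolynomial.eval₂_sum, MvPolynomial.eval₂_rename, Sum.elim_inr, Sum.elim_comp_inl]

/-- The form `λ₀ a_{0j} - ∑_{i ∈ S} λ_i σ_i a_{ij}`. -/
def linForm (c : K →+* B) (S : Finset (Fin m)) (σ : S → ℤˣ) (l : Option S → B) (j : Fin n) : B :=
  l none * c ((a n 0 (j.val + 1) : ℚ) : K) -
    ∑ i : S, l (some i) * (((σ i : ℤ) : B) * c ((a n (i.val.val + 1) (j.val + 1) : ℚ) : K))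

/-- The affine form `a_{i0} + ∑_j a_{ij} y_j`. -/
def affForm (c : K →+* B) (S : Finset (Fin m)) (y : Fin n → B) (i : S) : B :=
  c ((a n (i.val.val + 1) 0 : ℚ) : K) +
    ∑ j : Fin n, c ((a n (i.val.val + 1) (j.val + 1) : ℚ) : K) * y j

lemma eval₂_cheb (c : K →+* B) (d : ℕ) (j : Fin n) (x : Fin n → B) :
    MvPolynomial.eval₂ c x (cheb K n d j) = (Polynomial.Chebyshev.T B d).eval (x j) := by
  rw [cheb, ← MvPolynomial.coe_eval₂Hom, Polynomial.aeval_def, Polynomial.hom_eval₂,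
    MvPolynomial.coe_eval₂Hom, MvPolynomial.eval₂_X, ← Polynomial.Chebyshev.map_T c,
    Polynomial.eval_map]
  congr 1
  ext r
  simp [MvPolynomial.algebraMap_eq]

lemma eval₂_pderiv_cheb (c : K →+* B) (d : ℕ) (j k : Fin n) (x : Fin n → B) :
    MvPolynomial.eval₂ c x (MvPolynomial.pderiv k (cheb K n d j)) =
      if j = k then (Polynomial.derivative (Polynomial.Chebyshev.T B d)).eval (x j) else 0 := by
  rw [cheb, Derivation.map_aeval, MvPolynomial.pderiv_X, smul_eq_mul, MvPolynomial.eval₂_mul]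
  have : MvPolynomial.eval₂ c x (Polynomial.aeval (MvPolynomial.X j)
      (Polynomial.derivative (Polynomial.Chebyshev.T K d))) =
      (Polynomial.derivative (Polynomial.Chebyshev.T B d)).eval (x j) := by
    rw [← MvPolynomial.coe_eval₂Hom, Polynomial.aeval_def, Polynomial.hom_eval₂,
      MvPolynomial.coe_eval₂Hom, MvPolynomial.eval₂_X, ← Polynomial.Chebyshev.map_T c,
      Polynomial.derivative_map, Polynomial.eval_map]
    congr 1
    ext r
    simp [MvPolynomial.algebraMap_eq]
  rw [this]
  rcases eq_or_ne j k with rfl | h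
  · simp
  · simp [h]

lemma eval₂_fTildeSigned (c : K →+* B) (d : ℕ) (S : Finset (Fin m)) (σ : S → ℤˣ) (i : S)
    (x : Fin n → B) :
    MvPolynomial.eval₂ c x (fTildeSigned n d S σ i) =
      ((σ i : ℤ) : B) * affForm c S (fun j => (Polynomial.Chebyshev.T B d).eval (x j) + 1) i := by
  have h : ∀ z : ℤ, MvPolynomial.eval₂ c x ((z : ℤ) : MvPolynomial (Fin n) K) = (z : B) :=
    fun z => by rw [← MvPolynomial.coe_eval₂Hom, map_intCast]
  simp only [fTildeSigned, fTilde, affForm, MvPolynomial.eval₂_mul, h, MvPolynomial.eval₂_add,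
    MvPolynomial.eval₂_sum, MvPolynomial.eval₂_C, eval₂_cheb, MvPolynomial.eval₂_one]

lemma eval₂_pderiv_fTildeSigned (c : K →+* B) (d : ℕ) (S : Finset (Fin m)) (σ : S → ℤˣ) (i : S)
    (j : Fin n) (x : Fin n → B) :
    MvPolynomial.eval₂ c x (MvPolynomial.pderiv j (fTildeSigned n d S σ i)) =
      ((σ i : ℤ) : B) * c ((a n (i.val.val + 1) (j.val + 1) : ℚ) : K) *
        (Polynomial.derivative (Polynomial.Chebyshev.T B d)).eval (x j) := by
  have h : ∀ z : ℤ, MvPolynomial.eval₂ c x ((z : ℤ) : MvPolynomial (Fin n) K) = (z : B) :=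
    fun z => by rw [← MvPolynomial.coe_eval₂Hom, map_intCast]
  have h' : ∀ z : ℤ, MvPolynomial.pderiv j ((z : ℤ) : MvPolynomial (Fin n) K) = 0 :=
    fun z => by rw [← map_intCast (MvPolynomial.C (R := K) (σ := Fin n)), MvPolynomial.pderiv_C]
  simp only [fTildeSigned, fTilde, MvPolynomial.pderiv_mul, h', map_add, map_sum,
    MvPolynomial.pderiv_C, MvPolynomial.eval₂_mul, h, MvPolynomial.eval₂_sum,
    MvPolynomial.eval₂_C, eval₂_pderiv_cheb, MvPolynomial.pderiv_one,
    zero_mul, zero_add, add_zero, mul_ite, mul_zero, Finset.sum_ite_eq', Finset.mem_univ, if_true]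
  ring

lemma eval₂_pderiv_gTilde (c : K →+* B) (d : ℕ) (j : Fin n) (x : Fin n → B) :
    MvPolynomial.eval₂ c x (MvPolynomial.pderiv j (gTilde K n d)) =
      c ((a n 0 (j.val + 1) : ℚ) : K) *
        (Polynomial.derivative (Polynomial.Chebyshev.T B d)).eval (x j) := by
  simp only [gTilde, MvPolynomial.pderiv_mul, map_sum,
    MvPolynomial.pderiv_C, MvPolynomial.eval₂_mul, MvPolynomial.eval₂_sum,
    MvPolynomial.eval₂_C, eval₂_pderiv_cheb,
    zero_mul, zero_add, mul_ite, mul_zero, Finset.sum_ite_eq', Finset.mem_univ, if_true]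

/-- `g̃` and the `f̃_i` are sums of functions of one variable each, all proportional to `T_d` up to
constants. So `T_d'(x_j)` is a common factor of their partial derivatives in `x_j`. -/
lemma eval₂_gTildeLagrange (c : K →+* B) (d : ℕ) (S : Finset (Fin m)) (σ : S → ℤˣ)
    (j : Fin n) (x : Fin n → B) (l : Option S → B) :
    MvPolynomial.eval₂ c (Sum.elim x l) (gTildeLagrange d S σ j) =
      linForm c S σ l j *
        (Polynomial.derivative (Polynomial.Chebyshev.T B d)).eval (x j) := by
  rw [gTildeLagrange, eval₂_lagrange, eval₂_pderiv_gTilde, linForm, sub_mul, Finset.sum_mul]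
  simp only [eval₂_pderiv_fTildeSigned]
  congr 1
  · ring
  · exact Finset.sum_congr rfl fun i _ => by ring

lemma eval₂_F (ρ : K[X] →+* B) (d : ℕ) (f : Fin m → MvPolynomial (Fin n) K) (S : Finset (Fin m))
    (σ : S → ℤˣ) (i : S) (x : Fin n → B) :
    MvPolynomial.eval₂ ρ x (F d f S σ i) =
      ρ Polynomial.X * MvPolynomial.eval₂ (ρ.comp Polynomial.C) x (f i.val) +
        (1 - ρ Polynomial.X) * (((σ i : ℤ) : B) * affForm (ρ.comp Polynomial.C) S
          (fun j => (Polynomial.Chebyshev.T B d).eval (x j) + 1) i) := by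
  rw [F, eval₂_deform, eval₂_fTildeSigned]

lemma eval₂_G (ρ : K[X] →+* B) (d : ℕ) (f : Fin m → MvPolynomial (Fin n) K)
    (g : MvPolynomial (Fin n) K) (S : Finset (Fin m)) (σ : S → ℤˣ) (j : Fin n) (x : Fin n → B)
    (l : Option S → B) :
    MvPolynomial.eval₂ ρ (Sum.elim x l) (G d f g S σ j) =
      ρ Polynomial.X * (l none *
          MvPolynomial.eval₂ (ρ.comp Polynomial.C) x (MvPolynomial.pderiv j g) -
        ∑ i : S, l (some i) *
          MvPolynomial.eval₂ (ρ.comp Polynomial.C) x (MvPolynomial.pderiv j (f i.val))) +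
        (1 - ρ Polynomial.X) * (linForm (ρ.comp Polynomial.C) S σ l j *
          (Polynomial.derivative (Polynomial.Chebyshev.T B d)).eval (x j)) := by
  rw [G, eval₂_deform, eval₂_lagrange, eval₂_gTildeLagrange]

end Evaluation

/-! ### Vanishing linear and affine forms with Cauchy coefficients. -/

section LinearAlgebra

variable {K : Type*} [Field K] {n m : ℕ} {L : Type*} [Field L] [CharZero L]

lemma cast_q_sub_ne_zero (n i : ℕ) (j : Fin n) : (q n i : L) ≠ ((j.val + 1 : ℕ) : L) := by
  intro h
  have h1 : q n i = j.val + 1 := Nat.cast_injective h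
  have := lt_q n i
  have := j.isLt
  omega

lemma eq_zero_of_columns (c : K →+* L) (S : Finset (Fin m)) (T : Finset (Fin n))
    (hT : T.card ≤ S.card) (y : Fin n → L)
    (h : ∀ i : S, ∑ j ∈ T, c ((a n (i.val.val + 1) (j.val + 1) : ℚ) : K) * y j = 0) :
    ∀ j ∈ T, y j = 0 := by
  refine cauchy_injective (Finset.univ : Finset S) T (fun i => (q n (i.val.val + 1) : L))
    (fun j => ((j.val + 1 : ℕ) : L)) ?_ ?_ (fun i _ j _ => cast_q_sub_ne_zero n _ j) ?_ y ?_
  · intro i _ k _ hik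
    have := (q_strictMono n).injective (Nat.cast_injective hik)
    exact Subtype.ext (Fin.ext (by omega))
  · intro j _ k _ hjk
    have : j.val + 1 = k.val + 1 := Nat.cast_injective hjk
    exact Fin.ext (by omega)
  · rwa [Finset.card_univ, Fintype.card_coe]
  · intro i _
    rw [← h i]
    refine Finset.sum_congr rfl fun j _ => ?_
    rw [map_ratCast, cast_a]
    ring

/-- The transposed form of `eq_zero_of_columns`, with the row `0` included. The set `R` contains the
support of `λ`: all indices when `λ₀` is free, all but `none` when `λ₀ = 0`. -/
lemma eq_zero_of_rows (c : K →+* L) (S : Finset (Fin m)) (σ : S → ℤˣ) (R : Finset (Option S))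
    (T : Finset (Fin n)) (hT : R.card ≤ T.card) (l : Option S → L) (hl : ∀ o ∉ R, l o = 0)
    (h : ∀ j ∈ T, linForm c S σ l j = 0) : l = 0 := by
  set r : Option S → ℕ := fun o => o.elim 0 fun i => i.val.val + 1 with hr
  have hrinj : Function.Injective r := by
    rintro (_ | i) (_ | k) hik
    · rfl
    · simp [hr] at hik
    · simp [hr] at hik
    · have : i.val.val + 1 = k.val.val + 1 := hik
      exact congrArg some (Subtype.ext (Fin.ext (by omega)))
  set v : Option S → L := fun o => o.elim (l none) fun i => -(l (some i) * ((σ i : ℤ) : L)) with hv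
  -- Writing `1 / (q - j)` as `1 / (-j - (-q))` exchanges the roles of the two families of nodes.
  have key := cauchy_injective T R (fun j => -((j.val + 1 : ℕ) : L)) (fun o => -(q n (r o) : L))
    (fun j _ k _ hjk => by
      have : j.val + 1 = k.val + 1 := Nat.cast_injective (neg_injective hjk)
      exact Fin.ext (by omega))
    (fun o _ o' _ ho => hrinj ((q_strictMono n).injective (Nat.cast_injective (neg_injective ho))))
    (fun j _ o _ h => cast_q_sub_ne_zero n _ j (neg_injective h).symm) hT v ?_
  · have hv0 : ∀ o, v o = 0 := by
      intro o
      by_cases ho : o ∈ R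
      · exact key o ho
      · have := hl o ho
        rcases o with _ | i <;> simp [hv, this]
    funext o
    have h0 := hv0 o
    rcases o with _ | i
    · exact h0
    · simpa [hv] using h0
  · intro j hj
    rw [← h j hj]
    have h1 : ∑ o ∈ R, v o / (-((j.val + 1 : ℕ) : L) - -(q n (r o) : L)) =
        ∑ o : Option S, v o / (-((j.val + 1 : ℕ) : L) - -(q n (r o) : L)) := by
      refine Finset.sum_subset (Finset.subset_univ R) fun o _ ho => ?_
      have := hl o ho
      rcases o with _ | i <;> simp [hv, this]
    rw [h1, Fintype.sum_option, linForm, sub_eq_add_neg (l none * _), ← Finset.sum_neg_distrib]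
    congr 1
    · rw [map_ratCast, cast_a]
      simp only [hv, hr, Option.elim_none]
      ring
    · refine Finset.sum_congr rfl fun i _ => ?_
      rw [map_ratCast, cast_a]
      simp only [hv, hr, Option.elim_some]
      ring

-- If `s + 1` of the forms vanished, the `s + 1` unknowns `λ` would all be zero.
open Classical in
lemma card_linForm_eq_zero_le (c : K →+* L) (S : Finset (Fin m)) (σ : S → ℤˣ) (l : Option S → L)
    (hl : l ≠ 0) :
    (Finset.univ.filter fun j : Fin n => linForm c S σ l j = 0).card ≤ S.card := by
  by_contra! h
  refine hl (eq_zero_of_rows c S σ Finset.univ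
    (Finset.univ.filter fun j : Fin n => linForm c S σ l j = 0) ?_ l (fun o ho => (ho (Finset.mem_univ o)).elim)
    fun j hj => (Finset.mem_filter.mp hj).2)
  rwa [Finset.card_univ, Fintype.card_option, Fintype.card_coe]

-- If fewer than `s` coordinates lay outside `{0, 2}`, a combination of the affine equations would
-- eliminate all of them. What remains is the rational number that `combination_ne_zero` shows to be
-- nonzero.
open Classical in
lemma card_le_card_of_affForm_eq_zero (c : K →+* L) (S : Finset (Fin m)) (y : Fin n → L)
    (h : ∀ i, affForm c S y i = 0) :
    S.card ≤ (Finset.univ.filter fun j : Fin n => y j ≠ 0 ∧ y j ≠ 2).card := by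
  set T := Finset.univ.filter fun j : Fin n => y j ≠ 0 ∧ y j ≠ 2 with hT
  by_contra! hlt
  set J := Finset.univ.filter fun j : Fin n => y j = 2 with hJ
  have hlt' : T.card < (Finset.univ : Finset S).card := by
    rwa [Finset.card_univ, Fintype.card_coe]
  have hrinj : Set.InjOn (fun i : S => i.val.val) (Finset.univ : Finset S) :=
    fun i _ k _ hik => Subtype.ext (Fin.ext hik)
  refine combination_ne_zero n (Finset.univ : Finset S) (fun i => i.val.val) hrinj T J hlt' ?_
  set w : S → ℚ := fun i => Lagrange.nodalWeight (Finset.univ : Finset S)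
    (fun i => (q n (i.val.val + 1) : ℚ)) i *
    (∏ j ∈ T, ((q n (i.val.val + 1) : ℚ) - ((j.val + 1 : ℕ) : ℚ))) with hw
  have hcol : ∀ j ∈ T, ∑ i : S, w i * a n (i.val.val + 1) (j.val + 1) = 0 := by
    intro j hj
    have := sum_nodalWeight_mul_nodal_div (Finset.univ : Finset S) T
      (fun i => (q n (i.val.val + 1) : ℚ)) (fun j => ((j.val + 1 : ℕ) : ℚ))
      (fun i hi k hk hik => hrinj hi hk (by
        have := (q_strictMono n).injective (Nat.cast_injective hik)
        exact Nat.succ_injective this)) hlt' ((j.val + 1 : ℕ) : ℚ)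
      (fun i _ => (cast_q_sub_ne_zero n _ j).symm)
    rw [Finset.prod_eq_zero hj (sub_self _), zero_div, neg_zero] at this
    exact this
  rw [← Rat.cast_inj (α := L), Rat.cast_zero, Rat.cast_sum]
  have hterm : ∀ i : S, ((w i * (a n (i.val.val + 1) 0 +
      ∑ j ∈ J, a n (i.val.val + 1) (j.val + 1) * 2) : ℚ) : L) =
      -∑ j ∈ T, ((w i * a n (i.val.val + 1) (j.val + 1) : ℚ) : L) * y j := by
    intro i
    have h1 := h i
    have h2 : ∑ j : Fin n, c ((a n (i.val.val + 1) (j.val + 1) : ℚ) : K) * y j =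
        ∑ j ∈ T, ((a n (i.val.val + 1) (j.val + 1) : ℚ) : L) * y j +
        ∑ j ∈ J, ((a n (i.val.val + 1) (j.val + 1) : ℚ) : L) * 2 := by
      have hdisj : Disjoint T J := by
        rw [Finset.disjoint_left]
        intro j hj hj'
        exact (Finset.mem_filter.mp hj).2.2 (Finset.mem_filter.mp hj').2
      have h3 : ∑ j ∈ J, ((a n (i.val.val + 1) (j.val + 1) : ℚ) : L) * 2 =
          ∑ j ∈ J, ((a n (i.val.val + 1) (j.val + 1) : ℚ) : L) * y j :=
        Finset.sum_congr rfl fun j hj => by rw [(Finset.mem_filter.mp hj).2]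
      rw [h3, ← Finset.sum_union hdisj]
      simp only [map_ratCast]
      refine (Finset.sum_subset (Finset.subset_univ _) fun j _ hj => ?_).symm
      have : y j = 0 := by
        by_contra h0
        by_cases h2 : y j = 2
        · exact hj (Finset.mem_union_right _ (Finset.mem_filter.mpr ⟨Finset.mem_univ _, h2⟩))
        · exact hj (Finset.mem_union_left _ (Finset.mem_filter.mpr ⟨Finset.mem_univ _, h0, h2⟩))
      rw [this, mul_zero]
    rw [affForm, h2, map_ratCast] at h1
    have h4 : ∑ j ∈ T, ((w i * a n (i.val.val + 1) (j.val + 1) : ℚ) : L) * y j =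
        (w i : L) * ∑ j ∈ T, ((a n (i.val.val + 1) (j.val + 1) : ℚ) : L) * y j := by
      rw [Finset.mul_sum]
      exact Finset.sum_congr rfl fun j _ => by push_cast; ring
    rw [h4]
    push_cast
    linear_combination (w i : L) * h1
  rw [Finset.sum_congr rfl fun i _ => hterm i, Finset.sum_neg_distrib, Finset.sum_comm, neg_eq_zero]
  refine Finset.sum_eq_zero fun j hj => ?_
  rw [← Finset.sum_mul, ← Rat.cast_sum, hcol j hj, Rat.cast_zero, zero_mul]

end LinearAlgebra

/-! ### Hensel's lemma for square polynomial systems. -/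

section Hensel

open MvPolynomial

variable {R : Type*} [CommRing R] {ι : Type*}

lemma eval_sub_eval_mem (I : Ideal R) (p : MvPolynomial ι R) (x y : ι → R)
    (h : ∀ i, x i - y i ∈ I) : eval x p - eval y p ∈ I := by
  rw [← Ideal.Quotient.eq, ← eval₂_id, ← eval₂_id, eval₂_comp_left, eval₂_comp_left]
  congr 1
  funext i
  exact Ideal.Quotient.eq.mpr (h i)

variable [Fintype ι]

/-- First order Taylor expansion with remainder in `I ^ 2` for an increment in `I`. -/
lemma eval_add_sub_mem_sq (I : Ideal R) (p : MvPolynomial ι R) (x h : ι → R)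
    (hh : ∀ i, h i ∈ I) :
    eval (x + h) p - eval x p - ∑ i, eval x (pderiv i p) * h i ∈ I ^ 2 := by
  classical
  induction p using MvPolynomial.induction_on with
  | C r => simp
  | add p p' hp hp' =>
    have := add_mem hp hp'
    simp only [map_add, add_mul, Finset.sum_add_distrib]
    convert this using 1
    ring
  | mul_X p k hp =>
    have h1 : eval (x + h) p - eval x p ∈ I :=
      eval_sub_eval_mem I p _ _ fun i => by simpa using hh i
    have h2 : (eval (x + h) p - eval x p) * h k ∈ I ^ 2 := by
      rw [pow_two]; exact Ideal.mul_mem_mul h1 (hh k)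
    have h3 : ∑ i, eval x (pderiv i (p * X k)) * h i =
        (∑ i, eval x (pderiv i p) * h i) * x k + eval x p * h k := by
      simp only [Derivation.leibniz, pderiv_X, smul_eq_mul, map_add, map_mul, eval_X, add_mul,
        Finset.sum_add_distrib, Finset.sum_mul]
      rw [add_comm]
      congr 1
      · exact Finset.sum_congr rfl fun i _ => by ring
      · rw [Finset.sum_eq_single k]
        · simp
        · intro i _ hi
          simp [hi.symm]
        · exact fun hk => (hk (Finset.mem_univ _)).elim
    rw [h3]
    have := add_mem (Ideal.mul_mem_right (x k) _ hp) h2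
    convert this using 1
    simp only [map_mul, eval_X, Pi.add_apply]
    ring

/-- The Jacobian matrix of a square polynomial system at a point. -/
def jacobian (p : ι → MvPolynomial ι R) (x : ι → R) : Matrix ι ι R :=
  Matrix.of fun e i => eval x (pderiv i (p e))

lemma mulVec_mem {I : Ideal R} (M : Matrix ι ι R) {v : ι → R} (hv : ∀ i, v i ∈ I) (e : ι) :
    M.mulVec v e ∈ I :=
  Ideal.sum_mem _ fun i _ => Ideal.mul_mem_left _ _ (hv i)

lemma eval_add_sub_mulVec_mem_sq (I : Ideal R) (p : ι → MvPolynomial ι R) (x h : ι → R)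
    (hh : ∀ i, h i ∈ I) (e : ι) :
    eval (x + h) (p e) - eval x (p e) - (jacobian p x).mulVec h e ∈ I ^ 2 :=
  eval_add_sub_mem_sq I (p e) x h hh

variable [DecidableEq ι]

/-- Two zeros of a square system over a local ring that agree modulo the maximal ideal are equal,
if the Jacobian determinant is a unit. -/
lemma eq_of_isUnit_det_jacobian [IsLocalRing R] (p : ι → MvPolynomial ι R) (x y : ι → R)
    (hx : ∀ e, eval x (p e) = 0) (hy : ∀ e, eval y (p e) = 0)
    (hxy : ∀ i, y i - x i ∈ IsLocalRing.maximalIdeal R) (hJ : IsUnit (jacobian p x).det) :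
    x = y := by
  set h : ι → R := y - x with hh
  -- Taylor expansion modulo the square of the ideal generated by the differences gives `I ≤ I ^ 2`,
  -- and Nakayama's lemma then gives `I = 0`.
  set I : Ideal R := Ideal.span (Set.range h) with hI
  have hmem : ∀ i, h i ∈ I := fun i => Ideal.subset_span ⟨i, rfl⟩
  have h1 : ∀ e, (jacobian p x).mulVec h e ∈ I ^ 2 := by
    intro e
    have := eval_add_sub_mulVec_mem_sq I p x h hmem e
    rw [hh, add_sub_cancel, hx, hy, sub_zero, zero_sub] at this
    exact neg_mem_iff.mp this
  have h2 : ∀ e, h e ∈ I ^ 2 := by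
    intro e
    have := mulVec_mem (jacobian p x)⁻¹ h1 e
    rwa [Matrix.mulVec_mulVec, Matrix.nonsing_inv_mul _ hJ, Matrix.one_mulVec] at this
  have hIm : I ≤ IsLocalRing.maximalIdeal R := by
    rw [hI, Ideal.span_le]
    rintro _ ⟨i, rfl⟩
    exact hxy i
  have hI2 : I ≤ IsLocalRing.maximalIdeal R • I := by
    calc I ≤ I ^ 2 := by
          rw [hI, Ideal.span_le]
          rintro _ ⟨i, rfl⟩
          exact h2 i
      _ ≤ IsLocalRing.maximalIdeal R • I := by
          rw [pow_two, smul_eq_mul]; exact Ideal.mul_mono_left hIm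
  have hbot : I = ⊥ := Submodule.eq_bot_of_le_smul_of_le_jacobson_bot _ I
    (Submodule.fg_span (Set.finite_range h)) hI2 (IsLocalRing.maximalIdeal_le_jacobson _)
  funext i
  have := hmem i
  rw [hbot, Ideal.mem_bot, hh, Pi.sub_apply, sub_eq_zero] at this
  exact this.symm

/-- The multivariate Hensel lemma for square systems. -/
lemma exists_zero_of_isUnit_det_jacobian (I : Ideal R) [IsAdicComplete I R]
    (p : ι → MvPolynomial ι R) (x₀ : ι → R) (h0 : ∀ e, eval x₀ (p e) ∈ I)
    (hJ : IsUnit (jacobian p x₀).det) :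
    ∃ x : ι → R, (∀ e, eval x (p e) = 0) ∧ ∀ i, x i - x₀ i ∈ I := by
  set J := jacobian p x₀ with hJdef
  -- Newton's iteration with the inverse Jacobian frozen at `x₀`. Each step gains one power of `I`,
  -- which suffices for convergence and avoids inverting the Jacobian at each iterate.
  set step : (ι → R) → ι → R := fun x => x + -(J⁻¹.mulVec fun e => eval x (p e)) with hstep
  set u : ℕ → ι → R := fun k => step^[k] x₀ with hu
  have husucc : ∀ k, u (k + 1) = step (u k) := fun k => Function.iterate_succ_apply' _ _ _
  have hincr : ∀ k, (∀ e, eval (u k) (p e) ∈ I ^ (k + 1)) →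
      ∀ i, u (k + 1) i - u k i ∈ I ^ (k + 1) := by
    intro k hk i
    simp only [husucc, hstep, Pi.add_apply, add_sub_cancel_left, Pi.neg_apply]
    exact neg_mem (mulVec_mem _ hk i)
  have hmain : ∀ k, (∀ i, u k i - x₀ i ∈ I) ∧ ∀ e, eval (u k) (p e) ∈ I ^ (k + 1) := by
    intro k
    induction k with
    | zero =>
      refine ⟨fun i => ?_, fun e => by simpa [hu] using h0 e⟩
      simp [hu]
    | succ k ih =>
      obtain ⟨ih1, ih2⟩ := ih
      have hle : I ^ (k + 1) ≤ I := Ideal.pow_le_self (Nat.succ_ne_zero k)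
      refine ⟨fun i => ?_, fun e => ?_⟩
      · have := add_mem (hle (hincr k ih2 i)) (ih1 i)
        simpa using this
      · set v : ι → R := -(J⁻¹.mulVec fun e => eval (u k) (p e)) with hv
        have hvmem : ∀ i, v i ∈ I ^ (k + 1) := fun i => neg_mem (mulVec_mem _ ih2 i)
        have h1 := eval_add_sub_mulVec_mem_sq (I ^ (k + 1)) p (u k) v hvmem e
        have h2 : J.mulVec v = -fun e => eval (u k) (p e) := by
          rw [hv, Matrix.mulVec_neg, Matrix.mulVec_mulVec, Matrix.mul_nonsing_inv _ hJ,
            Matrix.one_mulVec]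
        -- The Jacobians at `u k` and at `x₀` agree modulo `I`, which makes up for freezing the
        -- Jacobian.
        have h3 : (jacobian p (u k)).mulVec v e - J.mulVec v e ∈ I ^ (k + 1 + 1) := by
          simp only [Matrix.mulVec, dotProduct, ← Finset.sum_sub_distrib]
          refine Ideal.sum_mem _ fun i _ => ?_
          rw [← sub_mul, pow_succ']
          exact Ideal.mul_mem_mul (eval_sub_eval_mem I _ _ _ ih1) (hvmem i)
        have h4 : (I ^ (k + 1)) ^ 2 ≤ I ^ (k + 1 + 1) := by
          rw [← pow_mul]; exact Ideal.pow_le_pow_right (by omega)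
        rw [husucc]
        have := add_mem (h4 h1) h3
        rw [h2] at this
        convert this using 1
        simp only [Pi.neg_apply, hstep]
        ring
  have hcauchy : ∀ i {k l : ℕ}, k ≤ l → u k i ≡ u l i [SMOD (I ^ k • ⊤ : Submodule R R)] := by
    intro i k l hkl
    induction l, hkl using Nat.le_induction with
    | base => exact SModEq.refl _
    | succ l hkl ih =>
      refine ih.trans (SModEq.symm ?_)
      rw [SModEq.sub_mem, smul_eq_mul, Ideal.mul_top]
      exact Ideal.pow_le_pow_right (hkl.trans (Nat.le_succ l)) (hincr l (hmain l).2 i)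
  have hlim : ∀ i, ∃ z : R, ∀ k, u k i ≡ z [SMOD (I ^ k • ⊤ : Submodule R R)] := fun i =>
    IsPrecomplete.prec inferInstance (hcauchy i)
  choose z hz using hlim
  have hz' : ∀ k i, u k i - z i ∈ I ^ k := by
    intro k i
    have := hz i k
    rwa [SModEq.sub_mem, smul_eq_mul, Ideal.mul_top] at this
  refine ⟨z, fun e => ?_, fun i => ?_⟩
  · refine IsHausdorff.haus (inferInstance : IsHausdorff I R) _ fun k => ?_
    rw [SModEq.zero, smul_eq_mul, Ideal.mul_top]
    have h1 := eval_sub_eval_mem (I ^ k) (p e) (u k) z (hz' k)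
    have h2 := Ideal.pow_le_pow_right (Nat.le_succ k) ((hmain k).2 e)
    simpa using sub_mem h2 h1
  · have h1 := hz' 1 i
    rw [pow_one] at h1
    simpa using sub_mem ((hmain 1).1 i) h1

end Hensel

/-! ### Finite zero sets under field extension. -/

section Nullstellensatz

open MvPolynomial

/-- If a polynomial system over an algebraically closed field has finitely many zeros, then its
zeros in any extension field are defined over the base field. -/
lemma exists_map_eq_of_finite_zeros {k L σ ι : Type*} [Field k] [IsAlgClosed k] [Field L]
    [Finite σ] (φ : k →+* L) (p : ι → MvPolynomial σ k)
    (hfin : {x : σ → k | ∀ e, eval x (p e) = 0}.Finite) (y : σ → L)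
    (hy : ∀ e, eval₂ φ y (p e) = 0) :
    ∃ x : σ → k, ∀ i, φ (x i) = y i := by
  -- It suffices to treat each coordinate separately: that the resulting point is itself a zero
  -- follows afterwards from the injectivity of `φ`.
  have key : ∀ i, ∃ c : k, φ c = y i := by
    intro i
    -- `Q` vanishes at all zeros over `k`, so a power of it lies in the ideal of the system. Hence
    -- `Q` vanishes at `y` too, and `y i` is the `i`-th coordinate of some zero over `k`.
    set Q : MvPolynomial σ k := ∏ z ∈ hfin.toFinset, (X i - C (z i)) with hQ
    have hQmem : Q ∈ (Ideal.span (Set.range p)).radical := by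
      rw [← vanishingIdeal_zeroLocus_eq_radical (K := k), mem_vanishingIdeal_iff]
      intro z hz
      rw [zeroLocus_span] at hz
      have hzmem : z ∈ hfin.toFinset := by
        rw [Set.Finite.mem_toFinset]
        intro e
        have := hz (p e) ⟨e, rfl⟩
        rwa [aeval_eq_eval] at this
      rw [aeval_eq_eval]
      simp only [hQ, map_prod]
      exact Finset.prod_eq_zero hzmem (by simp)
    obtain ⟨N, hN⟩ := hQmem
    have hker : Ideal.span (Set.range p) ≤ RingHom.ker (eval₂Hom φ y) := by
      rw [Ideal.span_le]
      rintro _ ⟨e, rfl⟩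
      exact hy e
    have h0 := hker hN
    rw [RingHom.mem_ker, map_pow] at h0
    have h1 := eq_zero_of_pow_eq_zero h0
    rw [hQ, map_prod, Finset.prod_eq_zero_iff] at h1
    obtain ⟨z, _, hz⟩ := h1
    refine ⟨z i, ?_⟩
    rw [map_sub, coe_eval₂Hom, eval₂_X, eval₂_C, sub_eq_zero] at hz
    exact hz.symm
  choose x hx using key
  exact ⟨x, hx⟩

end Nullstellensatz

/-! ### The dehomogenized square system and its specialization at `t = 0`. -/

section System

variable {K : Type*} [Field K] {n m : ℕ} {B : Type*} [CommRing B]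

/-- The square system dehomogenized with `λ₀ = 1`, with `G_j` at the index `j` and `F_i` at the
index `i`. -/
def system (d : ℕ) (f : Fin m → MvPolynomial (Fin n) K) (g : MvPolynomial (Fin n) K)
    (S : Finset (Fin m)) (σ : S → ℤˣ) : Fin n ⊕ S → MvPolynomial (Fin n ⊕ S) K[X] :=
  Sum.elim
    (fun j => MvPolynomial.bind₁ (Sum.elim (fun k => MvPolynomial.X (Sum.inl k))
      (dehom fun i => MvPolynomial.X (Sum.inr i))) (G d f g S σ j))
    (fun i => MvPolynomial.rename Sum.inl (F d f S σ i))

lemma eval₂_system_inl (ρ : K[X] →+* B) (d : ℕ) (f : Fin m → MvPolynomial (Fin n) K)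
    (g : MvPolynomial (Fin n) K) (S : Finset (Fin m)) (σ : S → ℤˣ)
    (P : (Fin n → B) × (S → B)) (j : Fin n) :
    MvPolynomial.eval₂ ρ (Sum.elim P.1 P.2) (system d f g S σ (Sum.inl j)) =
      MvPolynomial.eval₂ ρ (Sum.elim P.1 (dehom P.2)) (G d f g S σ j) := by
  rw [system, Sum.elim_inl, ← MvPolynomial.coe_eval₂Hom, MvPolynomial.eval₂Hom_bind₁]
  rw [MvPolynomial.coe_eval₂Hom]
  congr 1
  funext e
  rcases e with k | _ | i <;> simp [dehom]

lemma mem_affineZeros_iff (ρ : K[X] →+* B) (d : ℕ) (f : Fin m → MvPolynomial (Fin n) K)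
    (g : MvPolynomial (Fin n) K) (S : Finset (Fin m)) (σ : S → ℤˣ)
    (P : (Fin n → B) × (S → B)) :
    P ∈ affineZeros ρ d f g S σ ↔
      ∀ e, MvPolynomial.eval₂ ρ (Sum.elim P.1 P.2) (system d f g S σ e) = 0 := by
  rw [Sum.forall, and_comm]
  refine and_congr (forall_congr' fun i => ?_) (forall_congr' fun j => ?_)
  · rw [system, Sum.elim_inr, MvPolynomial.eval₂_rename, Sum.elim_comp_inl]
  · rw [eval₂_system_inl]

/-- The coordinatewise image of a point under a ring homomorphism. -/
def mapPoint {B' ι κ : Type*} [CommRing B'] (h : B →+* B') (P : (ι → B) × (κ → B)) :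
    (ι → B') × (κ → B') :=
  (fun j => h (P.1 j), fun i => h (P.2 i))

lemma mapPoint_injective {B' ι κ : Type*} [CommRing B'] (h : B →+* B')
    (hh : Function.Injective h) :
    Function.Injective (mapPoint h : (ι → B) × (κ → B) → (ι → B') × (κ → B')) := by
  intro P Q hPQ
  refine Prod.ext (funext fun j => hh ?_) (funext fun i => hh ?_)
  · exact congrFun (congrArg Prod.fst hPQ) j
  · exact congrFun (congrArg Prod.snd hPQ) i

lemma eval₂_system_mapPoint {B' : Type*} [CommRing B'] (h : B →+* B') (ρ : K[X] →+* B) (d : ℕ)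
    (f : Fin m → MvPolynomial (Fin n) K) (g : MvPolynomial (Fin n) K) (S : Finset (Fin m))
    (σ : S → ℤˣ) (P : (Fin n → B) × (S → B)) (e : Fin n ⊕ S) :
    MvPolynomial.eval₂ (h.comp ρ) (Sum.elim (mapPoint h P).1 (mapPoint h P).2)
      (system d f g S σ e) =
      h (MvPolynomial.eval₂ ρ (Sum.elim P.1 P.2) (system d f g S σ e)) := by
  rw [MvPolynomial.eval₂_comp_left]
  congr 1
  funext e
  rcases e with j | i <;> rfl

lemma mapPoint_mem_affineZeros {B' : Type*} [CommRing B'] (h : B →+* B') {ρ : K[X] →+* B} {d : ℕ}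
    {f : Fin m → MvPolynomial (Fin n) K} {g : MvPolynomial (Fin n) K} {S : Finset (Fin m)}
    {σ : S → ℤˣ} {P : (Fin n → B) × (S → B)} (hP : P ∈ affineZeros ρ d f g S σ) :
    mapPoint h P ∈ affineZeros (h.comp ρ) d f g S σ := by
  rw [mem_affineZeros_iff] at hP ⊢
  intro e
  rw [eval₂_system_mapPoint, hP e, map_zero]

lemma mapPoint_mem_affineZeros_iff {B' : Type*} [CommRing B'] (h : B →+* B')
    (hh : Function.Injective h) {ρ : K[X] →+* B} {d : ℕ}
    {f : Fin m → MvPolynomial (Fin n) K} {g : MvPolynomial (Fin n) K} {S : Finset (Fin m)}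
    {σ : S → ℤˣ} {P : (Fin n → B) × (S → B)} :
    mapPoint h P ∈ affineZeros (h.comp ρ) d f g S σ ↔ P ∈ affineZeros ρ d f g S σ := by
  refine ⟨fun hP => ?_, mapPoint_mem_affineZeros h⟩
  rw [mem_affineZeros_iff] at hP ⊢
  intro e
  have := hP e
  rwa [eval₂_system_mapPoint, map_eq_zero_iff h hh] at this

lemma mem_affineZeros_iff_of_map_X_eq_zero {ρ : K[X] →+* B} (hρ : ρ Polynomial.X = 0) {d : ℕ}
    {f : Fin m → MvPolynomial (Fin n) K} {g : MvPolynomial (Fin n) K} {S : Finset (Fin m)}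
    {σ : S → ℤˣ} {P : (Fin n → B) × (S → B)} :
    P ∈ affineZeros ρ d f g S σ ↔
      (∀ i, affForm (ρ.comp Polynomial.C) S
        (fun j => (Polynomial.Chebyshev.T B d).eval (P.1 j) + 1) i = 0) ∧
      ∀ j, linForm (ρ.comp Polynomial.C) S σ (dehom P.2) j *
        (Polynomial.derivative (Polynomial.Chebyshev.T B d)).eval (P.1 j) = 0 := by
  refine and_congr (forall_congr' fun i => ?_) (forall_congr' fun j => ?_)
  · rw [eval₂_F, hρ, zero_mul, zero_add, sub_zero, one_mul]
    rcases Int.units_eq_one_or (σ i) with h | h <;> simp [h]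
  · rw [eval₂_G, hρ, zero_mul, zero_add, sub_zero, one_mul]

lemma initialZeros_eq (L : Type*) [Field L] [Algebra K L] {ρ : K[X] →+* L}
    (hρ : ρ Polynomial.X = 0) (hC : ρ.comp Polynomial.C = algebraMap K L) (d : ℕ)
    (f : Fin m → MvPolynomial (Fin n) K) (g : MvPolynomial (Fin n) K) (S : Finset (Fin m))
    (σ : S → ℤˣ) :
    initialZeros (K := K) L n d S σ = affineZeros ρ d f g S σ := by
  ext P
  refine and_congr (forall_congr' fun i => ?_) (forall_congr' fun j => ?_)
  · rw [F, eval₂_deform, hρ, zero_mul, zero_add, sub_zero, one_mul, hC, MvPolynomial.aeval_def]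
  · rw [G, eval₂_deform, hρ, zero_mul, zero_add, sub_zero, one_mul, hC, MvPolynomial.aeval_def]

end System

/-! ### Derivatives by means of dual numbers. -/

section DualNumbers

open TrivSqZeroExt

variable {K : Type*} [Field K] {n m : ℕ} {L : Type*} [Field L]

/-- Taylor's formula is exact to first order because `ε² = 0`. Tangent vectors become points over
the dual numbers, to which the formulas of the system over arbitrary rings apply directly. -/
lemma eval_map_inlHom {R : Type*} [CommRing R] (p : R[X]) (x x' : R) :
    (p.map (inlHom R R)).eval (inl x + inr x' : DualNumber R) =
      inl (p.eval x) + inr (p.derivative.eval x * x') := by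
  have hx : ∀ r : R[X], (r.map (inlHom R R)).eval (inl x) = inl (r.eval x) := fun r => by
    rw [Polynomial.eval_map]
    exact Polynomial.eval₂_at_apply (inlHom R R) x
  rw [Polynomial.eval_add_of_sq_eq_zero _ _ _ (by rw [pow_two, inr_mul_inr]),
    Polynomial.derivative_map, hx, hx, inl_mul_inr, smul_eq_mul]

lemma snd_affForm (c : K →+* L) (S : Finset (Fin m)) (y : Fin n → DualNumber L) (i : S) :
    snd (affForm ((inlHom L L).comp c) S y i) =
      ∑ j : Fin n, c ((a n (i.val.val + 1) (j.val + 1) : ℚ) : K) * snd (y j) := by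
  simp [affForm, snd_sum]

lemma fst_linForm (c : K →+* L) (S : Finset (Fin m)) (σ : S → ℤˣ) (l : Option S → DualNumber L)
    (j : Fin n) :
    fst (linForm ((inlHom L L).comp c) S σ l j) = linForm c S σ (fun o => fst (l o)) j := by
  simp [linForm, fst_sum]

lemma snd_linForm (c : K →+* L) (S : Finset (Fin m)) (σ : S → ℤˣ) (l : Option S → DualNumber L)
    (j : Fin n) :
    snd (linForm ((inlHom L L).comp c) S σ l j) = linForm c S σ (fun o => snd (l o)) j := by
  simp [linForm, snd_sum]

end DualNumbers

lemma dehom_ne_zero {m : ℕ} {L : Type*} [Field L] {S : Finset (Fin m)} (l : S → L) :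
    dehom l ≠ 0 := fun h => one_ne_zero (congrFun h none)

/-! ### Structure and nondegeneracy of the initial zeros. -/

section Initial

variable {K : Type*} [Field K] {n m : ℕ} {L : Type*} [Field L] [CharZero L]

open Classical in
/-- The structure of a zero of the initial system: `s` of the linear forms in `λ` vanish, and the
other coordinates of `x` are critical points of `T_d`. -/
lemma initial_structure {ρ : K[X] →+* L} (hρ : ρ Polynomial.X = 0) {d : ℕ} (hd : 0 < d)
    {f : Fin m → MvPolynomial (Fin n) K} {g : MvPolynomial (Fin n) K} {S : Finset (Fin m)}
    {σ : S → ℤˣ} {P : (Fin n → L) × (S → L)} (hP : P ∈ affineZeros ρ d f g S σ) :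
    (Finset.univ.filter fun j : Fin n => linForm (ρ.comp Polynomial.C) S σ (dehom P.2) j = 0).card =
      S.card ∧
    ∀ j, linForm (ρ.comp Polynomial.C) S σ (dehom P.2) j = 0 ↔
      (Polynomial.derivative (Polynomial.Chebyshev.T L d)).eval (P.1 j) ≠ 0 := by
  rw [mem_affineZeros_iff_of_map_X_eq_zero hρ] at hP
  obtain ⟨h1, h2⟩ := hP
  have hc1 := card_le_card_of_affForm_eq_zero (ρ.comp Polynomial.C) S _ h1
  have hc2 := card_linForm_eq_zero_le (n := n) (ρ.comp Polynomial.C) S σ (dehom P.2)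
    (dehom_ne_zero P.2)
  set Y := Finset.univ.filter fun j : Fin n =>
    (Polynomial.Chebyshev.T L d).eval (P.1 j) + 1 ≠ 0 ∧
    (Polynomial.Chebyshev.T L d).eval (P.1 j) + 1 ≠ 2 with hY
  set T := Finset.univ.filter fun j : Fin n =>
    linForm (ρ.comp Polynomial.C) S σ (dehom P.2) j = 0 with hT
  have hcrit : ∀ j ∈ Y,
      (Polynomial.derivative (Polynomial.Chebyshev.T L d)).eval (P.1 j) ≠ 0 := by
    intro j hj h0
    obtain ⟨_, h3, h4⟩ := Finset.mem_filter.mp hj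
    rcases chebyshev_T_eval_of_critical hd h0 with h | h
    · exact h4 (by rw [h]; norm_num)
    · exact h3 (by rw [h]; norm_num)
  -- Together with `#T ≤ s ≤ #Y` this inclusion forces `Y = T`.
  have hYT : Y ⊆ T := fun j hj => Finset.mem_filter.mpr
    ⟨Finset.mem_univ _, (mul_eq_zero.mp (h2 j)).resolve_right (hcrit j hj)⟩
  have hYTeq : Y = T := Finset.eq_of_subset_of_card_le hYT (hc2.trans hc1)
  refine ⟨le_antisymm hc2 (hYTeq ▸ hc1), fun j => ⟨fun hj => hcrit j ?_, fun hj => ?_⟩⟩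
  · rw [hYTeq]
    exact Finset.mem_filter.mpr ⟨Finset.mem_univ _, hj⟩
  · exact (mul_eq_zero.mp (h2 j)).resolve_right hj

section Tangent

open TrivSqZeroExt

/-- The initial system has no nonzero tangent vectors at its zeros. -/
lemma tangent_eq_zero {ρ : K[X] →+* L} (hρ : ρ Polynomial.X = 0) {d : ℕ} (hd : 0 < d)
    {f : Fin m → MvPolynomial (Fin n) K} {g : MvPolynomial (Fin n) K} {S : Finset (Fin m)}
    {σ : S → ℤˣ} {P : (Fin n → L) × (S → L)} (hP : P ∈ affineZeros ρ d f g S σ)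
    (v : (Fin n → L) × (S → L))
    (hv : ((fun j => inl (P.1 j) + inr (v.1 j), fun i => inl (P.2 i) + inr (v.2 i)) :
      (Fin n → DualNumber L) × (S → DualNumber L)) ∈
        affineZeros ((inlHom L L).comp ρ) d f g S σ) :
    v = 0 := by
  classical
  obtain ⟨hcard, hst⟩ := initial_structure hρ hd hP
  set c : K →+* L := ρ.comp Polynomial.C with hc
  have hρ' : ((inlHom L L).comp ρ) Polynomial.X = 0 := by
    rw [RingHom.comp_apply, hρ, map_zero]
  rw [mem_affineZeros_iff_of_map_X_eq_zero hρ'] at hv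
  obtain ⟨h1, h2⟩ := hv
  rw [RingHom.comp_assoc, ← hc, ← Polynomial.Chebyshev.map_T (inlHom L L)] at h1 h2
  rw [Polynomial.derivative_map] at h2
  simp only [eval_map_inlHom] at h1 h2
  -- The tangent component of `λ₀` is zero, since `λ₀ = 1` is held constant.
  set l' : Option S → L := fun o => o.elim 0 v.2 with hl'
  have hfst : (fun o => fst (dehom (fun i => inl (P.2 i) + inr (v.2 i) : S → DualNumber L) o)) =
      dehom P.2 := by
    funext o
    rcases o with _ | i <;> simp [dehom]
  have hsnd : (fun o => snd (dehom (fun i => inl (P.2 i) + inr (v.2 i) : S → DualNumber L) o)) =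
      l' := by
    funext o
    rcases o with _ | i <;> simp [dehom, hl']
  have h1' : ∀ i : S, ∑ j : Fin n, c ((a n (i.val.val + 1) (j.val + 1) : ℚ) : K) *
      ((Polynomial.derivative (Polynomial.Chebyshev.T L d)).eval (P.1 j) * v.1 j) = 0 := by
    intro i
    have := congrArg snd (h1 i)
    rw [snd_affForm] at this
    simpa using this
  have h2' : ∀ j, linForm c S σ (dehom P.2) j *
      ((Polynomial.derivative (Polynomial.derivative (Polynomial.Chebyshev.T L d))).eval (P.1 j) *
        v.1 j) + linForm c S σ l' j *
      (Polynomial.derivative (Polynomial.Chebyshev.T L d)).eval (P.1 j) = 0 := by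
    intro j
    have := congrArg snd (h2 j)
    rw [DualNumber.snd_mul, fst_linForm, snd_linForm, hfst, hsnd] at this
    simpa using this
  set T := Finset.univ.filter fun j : Fin n => linForm c S σ (dehom P.2) j = 0 with hT
  -- On `T` the form vanishes and `T_d'` does not, so the derived equation leaves `s` linear
  -- equations for the `s` tangent components of `λ`.
  have hlin : ∀ j ∈ T, linForm c S σ l' j = 0 := by
    intro j hj
    have hj' := (Finset.mem_filter.mp hj).2
    have := h2' j
    rw [hj', zero_mul, zero_add] at this
    exact (mul_eq_zero.mp this).resolve_right ((hst j).mp hj')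
  have hl0 : l' = 0 := by
    refine eq_zero_of_rows c S σ (Finset.univ.erase none) T ?_ l' ?_ hlin
    · rw [hcard, Finset.card_erase_of_mem (Finset.mem_univ _), Finset.card_univ,
        Fintype.card_option, Fintype.card_coe, Nat.add_sub_cancel]
    · rintro (_ | i) ho
      · rfl
      · exact (ho (Finset.mem_erase.mpr ⟨Option.some_ne_none i, Finset.mem_univ _⟩)).elim
  -- Off `T` the coordinate is a critical point and the form is nonzero; nondegeneracy of the
  -- critical point gives `v_j = 0`.
  have hoff : ∀ j ∉ T, v.1 j = 0 := by
    intro j hj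
    have hj' : linForm c S σ (dehom P.2) j ≠ 0 := fun h =>
      hj (Finset.mem_filter.mpr ⟨Finset.mem_univ _, h⟩)
    have hcrit : (Polynomial.derivative (Polynomial.Chebyshev.T L d)).eval (P.1 j) = 0 := by
      by_contra h
      exact hj' ((hst j).mpr h)
    have := h2' j
    rw [hcrit, mul_zero, add_zero] at this
    exact (mul_eq_zero.mp ((mul_eq_zero.mp this).resolve_left hj')).resolve_left
      (chebyshev_second_derivative_ne_zero hd hcrit)
  -- The derived affine equations now involve only the `s` columns in `T`.
  have hon := eq_zero_of_columns c S T hcard.le (fun j =>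
    (Polynomial.derivative (Polynomial.Chebyshev.T L d)).eval (P.1 j) * v.1 j) (fun i => by
      rw [← h1' i]
      refine Finset.sum_subset (Finset.subset_univ _) fun j _ hj => ?_
      rw [hoff j hj, mul_zero, mul_zero])
  refine Prod.ext (funext fun j => ?_) (funext fun i => congrFun hl0 (some i))
  by_cases hj : j ∈ T
  · exact (mul_eq_zero.mp (hon j hj)).resolve_left
      ((hst j).mp (Finset.mem_filter.mp hj).2)
  · exact hoff j hj

/-- The Jacobian determinant of the deformed system does not vanish at the zeros at `t = 0`. -/
lemma det_jacobian_ne_zero {ρ : K[X] →+* L} (hρ : ρ Polynomial.X = 0) {d : ℕ} (hd : 0 < d)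
    {f : Fin m → MvPolynomial (Fin n) K} {g : MvPolynomial (Fin n) K} {S : Finset (Fin m)}
    {σ : S → ℤˣ} {P : (Fin n → L) × (S → L)} (hP : P ∈ affineZeros ρ d f g S σ) :
    (jacobian (fun e => MvPolynomial.map ρ (system d f g S σ e)) (Sum.elim P.1 P.2)).det ≠ 0 := by
  set p := fun e => MvPolynomial.map ρ (system d f g S σ e) with hp
  set x : Fin n ⊕ S → L := Sum.elim P.1 P.2 with hx
  intro hdet
  obtain ⟨v, hv0, hv⟩ := Matrix.exists_mulVec_eq_zero_iff.mpr hdet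
  refine hv0 ?_
  have hpx : ∀ e, MvPolynomial.eval x (p e) = 0 := by
    intro e
    rw [hp, MvPolynomial.eval_map]
    exact (mem_affineZeros_iff ρ d f g S σ P).mp hP e
  set p' : Fin n ⊕ S → MvPolynomial (Fin n ⊕ S) (DualNumber L) :=
    fun e => MvPolynomial.map (inlHom L L) (p e) with hp'
  have hinl : ∀ r : MvPolynomial (Fin n ⊕ S) L,
      MvPolynomial.eval (fun i => inl (x i)) (MvPolynomial.map (inlHom L L) r) =
        (inl (MvPolynomial.eval x r) : DualNumber L) := by
    intro r
    rw [MvPolynomial.eval_map]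
    have h := (MvPolynomial.eval₂_comp_left (inlHom L L) (RingHom.id L) x r).symm
    rwa [RingHom.comp_id, MvPolynomial.eval₂_id] at h
  have key : ∀ e, MvPolynomial.eval (fun i => inl (x i) + inr (v i)) (p' e) = 0 := by
    intro e
    have h1 := eval_add_sub_mulVec_mem_sq (Ideal.span {(DualNumber.eps : DualNumber L)}) p'
      (fun i => inl (x i)) (fun i => inr (v i))
      (fun i => Ideal.mem_span_singleton.mpr ⟨inl (v i), by
        rw [DualNumber.eps, inr_mul_inl]; simp⟩) e
    -- The remainder of the Taylor expansion lies in `(ε)² = 0`, so a kernel vector of the Jacobian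
    -- is a tangent vector of the system.
    have h2 : (Ideal.span {(DualNumber.eps : DualNumber L)}) ^ 2 = ⊥ := by
      rw [Ideal.span_singleton_pow, pow_two, DualNumber.eps_mul_eps, Ideal.span_singleton_zero]
    have h3 : (jacobian p' fun i => inl (x i)).mulVec (fun i => inr (v i)) e =
        (inr ((jacobian p x).mulVec v e) : DualNumber L) := by
      simp only [Matrix.mulVec, dotProduct, jacobian, Matrix.of_apply, hp', MvPolynomial.pderiv_map,
        hinl, inl_mul_inr, inr_sum, smul_eq_mul]
    rw [h2, Ideal.mem_bot, h3, hv, hp'] at h1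
    simp only [hinl, hpx, Pi.zero_apply, inr_zero, inl_zero, sub_zero] at h1
    exact h1
  have h4 := tangent_eq_zero hρ hd hP (fun j => v (Sum.inl j), fun i => v (Sum.inr i)) (by
    rw [mem_affineZeros_iff]
    intro e
    have := key e
    simp only [hp', hp] at this
    rw [MvPolynomial.map_map, MvPolynomial.eval_map] at this
    rw [← this]
    congr 1
    funext e
    rcases e with j | i <;> rfl)
  funext e
  rcases e with j | i
  · exact congrFun (congrArg Prod.fst h4) j
  · exact congrFun (congrArg Prod.snd h4) i

end Tangent

end Initial

/-! ### The number of initial zeros. -/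

section Counting

variable {K : Type*} [Field K] {n m : ℕ} {L : Type*} [Field L]

lemma linForm_sub (c : K →+* L) (S : Finset (Fin m)) (σ : S → ℤˣ) (l l' : Option S → L)
    (j : Fin n) : linForm c S σ (l - l') j = linForm c S σ l j - linForm c S σ l' j := by
  simp only [linForm, Pi.sub_apply, sub_mul, Finset.sum_sub_distrib]
  ring

variable [CharZero L]

/-- Values of `y` outside a set of `s` coordinates extend to a solution of the affine equations. -/
lemma exists_affForm_eq_zero (c : K →+* L) (S : Finset (Fin m)) (T : Finset (Fin n))
    (hT : T.card = S.card) (w : Fin n → L) :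
    ∃ y : Fin n → L, (∀ j ∉ T, y j = w j) ∧ ∀ i, affForm c S y i = 0 := by
  classical
  set A : (T → L) →ₗ[L] (S → L) := Matrix.mulVecLin
    (Matrix.of fun i j => c ((a n (i.val.val + 1) (j.val.val + 1) : ℚ) : K)) with hA
  have hinj : Function.Injective A := by
    rw [← LinearMap.ker_eq_bot, LinearMap.ker_eq_bot']
    intro v hv
    have h := eq_zero_of_columns c S T hT.le (fun j => if h : j ∈ T then v ⟨j, h⟩ else 0) (by
      intro i
      have := congrFun hv i
      simp only [hA, Matrix.mulVecLin_apply, Matrix.mulVec, dotProduct, Matrix.of_apply,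
        Pi.zero_apply] at this
      rw [← this, ← Finset.sum_coe_sort]
      refine Finset.sum_congr rfl fun j _ => ?_
      rw [dif_pos j.2])
    funext j
    have := h j.1 j.2
    rwa [dif_pos j.2] at this
  have hsurj : Function.Surjective A := by
    refine (LinearMap.injective_iff_surjective_of_finrank_eq_finrank ?_).mp hinj
    simp [hT]
  set w' : Fin n → L := fun j => if j ∈ T then 0 else w j with hw'
  obtain ⟨v, hv⟩ := hsurj fun i => -affForm c S w' i
  refine ⟨fun j => if h : j ∈ T then v ⟨j, h⟩ else w j, fun j hj => dif_neg hj, fun i => ?_⟩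
  have h1 := congrFun hv i
  simp only [hA, Matrix.mulVecLin_apply, Matrix.mulVec, dotProduct, Matrix.of_apply] at h1
  have h2 : ∑ j : Fin n, c ((a n (i.val.val + 1) (j.val + 1) : ℚ) : K) *
      (if h : j ∈ T then v ⟨j, h⟩ else w j) =
      ∑ j : T, c ((a n (i.val.val + 1) (j.val.val + 1) : ℚ) : K) * v j +
      ∑ j : Fin n, c ((a n (i.val.val + 1) (j.val + 1) : ℚ) : K) * w' j := by
    have h3 : ∑ j : T, c ((a n (i.val.val + 1) (j.val.val + 1) : ℚ) : K) * v j =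
        ∑ j : Fin n, c ((a n (i.val.val + 1) (j.val + 1) : ℚ) : K) *
          (if h : j ∈ T then v ⟨j, h⟩ else 0) := by
      rw [← Finset.sum_subset (Finset.subset_univ T), ← Finset.sum_coe_sort T]
      · exact Finset.sum_congr rfl fun j _ => by rw [dif_pos j.2]
      · intro j _ hj
        rw [dif_neg hj, mul_zero]
    rw [h3, ← Finset.sum_add_distrib]
    refine Finset.sum_congr rfl fun j _ => ?_
    by_cases hj : j ∈ T <;> simp [hw', hj]
  rw [affForm, h2, h1, affForm]
  ring

/-- The values of `y` outside a set of at most `s` coordinates determine the solution of the affine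
equations. -/
lemma affForm_unique (c : K →+* L) (S : Finset (Fin m)) (T : Finset (Fin n))
    (hT : T.card ≤ S.card) (y y' : Fin n → L) (hyy : ∀ j ∉ T, y j = y' j)
    (hy : ∀ i, affForm c S y i = 0) (hy' : ∀ i, affForm c S y' i = 0) : y = y' := by
  have h := eq_zero_of_columns c S T hT (fun j => y j - y' j) (by
    intro i
    have h1 : ∑ j ∈ T, c ((a n (i.val.val + 1) (j.val + 1) : ℚ) : K) * (y j - y' j) =
        ∑ j, c ((a n (i.val.val + 1) (j.val + 1) : ℚ) : K) * (y j - y' j) :=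
      Finset.sum_subset (Finset.subset_univ T) fun j _ hj => by
        rw [hyy j hj, sub_self, mul_zero]
    rw [h1]
    simp only [mul_sub, Finset.sum_sub_distrib]
    have h2 := hy i
    have h3 := hy' i
    rw [affForm] at h2 h3
    linear_combination h2 - h3)
  funext j
  by_cases hj : j ∈ T
  · exact sub_eq_zero.mp (h j hj)
  · exact hyy j hj

lemma exists_linForm_eq_zero (c : K →+* L) (S : Finset (Fin m)) (σ : S → ℤˣ)
    (T : Finset (Fin n)) (hT : T.card = S.card) :
    ∃ l : S → L, ∀ j ∈ T, linForm c S σ (dehom l) j = 0 := by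
  classical
  set A : (S → L) →ₗ[L] (T → L) := Matrix.mulVecLin
    (Matrix.of fun j i => ((σ i : ℤ) : L) * c ((a n (i.val.val + 1) (j.val.val + 1) : ℚ) : K))
    with hA
  have hinj : Function.Injective A := by
    rw [← LinearMap.ker_eq_bot, LinearMap.ker_eq_bot']
    intro v hv
    have h := eq_zero_of_rows c S σ (Finset.univ.erase none) T (by
        rw [hT, Finset.card_erase_of_mem (Finset.mem_univ _), Finset.card_univ,
          Fintype.card_option, Fintype.card_coe, Nat.add_sub_cancel])
      (fun o => o.elim 0 v) (by
        rintro (_ | i) ho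
        · rfl
        · exact (ho (Finset.mem_erase.mpr ⟨Option.some_ne_none i, Finset.mem_univ _⟩)).elim) (by
        intro j hj
        have := congrFun hv ⟨j, hj⟩
        simp only [hA, Matrix.mulVecLin_apply, Matrix.mulVec, dotProduct, Matrix.of_apply,
          Pi.zero_apply] at this
        rw [linForm, Option.elim_none, zero_mul, zero_sub, ← neg_zero, ← this]
        refine congrArg _ (Finset.sum_congr rfl fun i _ => ?_)
        exact mul_comm _ _)
    exact funext fun i => congrFun h (some i)
  have hsurj : Function.Surjective A := by
    refine (LinearMap.injective_iff_surjective_of_finrank_eq_finrank ?_).mp hinj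
    simp [hT]
  obtain ⟨l, hl⟩ := hsurj fun j => c ((a n 0 (j.val.val + 1) : ℚ) : K)
  refine ⟨l, fun j hj => ?_⟩
  have := congrFun hl ⟨j, hj⟩
  simp only [hA, Matrix.mulVecLin_apply, Matrix.mulVec, dotProduct, Matrix.of_apply] at this
  rw [linForm, ← this]
  simp only [dehom, Option.elim_none, Option.elim_some, one_mul]
  rw [sub_eq_zero]
  exact Finset.sum_congr rfl fun i _ => mul_comm _ _

lemma linForm_unique (c : K →+* L) (S : Finset (Fin m)) (σ : S → ℤˣ) (T : Finset (Fin n))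
    (hT : T.card = S.card) (l l' : S → L) (hl : ∀ j ∈ T, linForm c S σ (dehom l) j = 0)
    (hl' : ∀ j ∈ T, linForm c S σ (dehom l') j = 0) : l = l' := by
  classical
  have h := eq_zero_of_rows c S σ (Finset.univ.erase none) T (by
      rw [hT, Finset.card_erase_of_mem (Finset.mem_univ _), Finset.card_univ,
        Fintype.card_option, Fintype.card_coe, Nat.add_sub_cancel])
    (dehom l - dehom l') (by
      rintro (_ | i) ho
      · simp [dehom]
      · exact (ho (Finset.mem_erase.mpr ⟨Option.some_ne_none i, Finset.mem_univ _⟩)).elim)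
    (fun j hj => by rw [linForm_sub, hl j hj, hl' j hj, sub_zero])
  exact funext fun i => sub_eq_zero.mp (congrFun h (some i))

/-- A zero of the initial system is determined by its projection to the `x`-space. -/
lemma initial_fst_injective {ρ : K[X] →+* L} (hρ : ρ Polynomial.X = 0) {d : ℕ} (hd : 0 < d)
    {f : Fin m → MvPolynomial (Fin n) K} {g : MvPolynomial (Fin n) K} {S : Finset (Fin m)}
    {σ : S → ℤˣ} {P Q : (Fin n → L) × (S → L)} (hP : P ∈ affineZeros ρ d f g S σ)
    (hQ : Q ∈ affineZeros ρ d f g S σ) (hPQ : P.1 = Q.1) : P = Q := by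
  classical
  obtain ⟨hcard, hst⟩ := initial_structure hρ hd hP
  obtain ⟨_, hst'⟩ := initial_structure hρ hd hQ
  refine Prod.ext hPQ (linForm_unique _ S σ _ hcard _ _ (fun j hj => (Finset.mem_filter.mp hj).2)
    fun j hj => ?_)
  rw [hst', ← hPQ, ← hst]
  exact (Finset.mem_filter.mp hj).2

/-- An initial zero amounts to three independent choices: the set `T` of the `s` coordinates with
vanishing form, a critical point for each coordinate off `T`, and on `T` a preimage of each
prescribed value. The first two choices determine `y` by the affine equations, and `T` determines
`λ`. The value of `y` at each index in `T` is neither `0` nor `2`, so it has exactly `d` preimages.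
-/
lemma natCard_affineZeros_initial [IsAlgClosed L] {ρ : K[X] →+* L} (hρ : ρ Polynomial.X = 0)
    {d : ℕ} (hd : 0 < d) (f : Fin m → MvPolynomial (Fin n) K) (g : MvPolynomial (Fin n) K)
    (S : Finset (Fin m)) (σ : S → ℤˣ) :
    Nat.card (affineZeros ρ d f g S σ) = bezoutNumber n d S.card := by
  classical
  set c : K →+* L := ρ.comp Polynomial.C with hc
  set Crit : Type _ := {x : L // (Polynomial.derivative (Polynomial.Chebyshev.T L d)).eval x = 0}
    with hCrit
  set Tev : L → L := fun x => (Polynomial.Chebyshev.T L d).eval x with hTev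
  have hY : ∀ (T : {T : Finset (Fin n) // T.card = S.card})
      (u : {j : Fin n // j ∉ T.1} → Crit),
      ∃ y : Fin n → L, (∀ (j : Fin n) (h : j ∉ T.1), y j = Tev (u ⟨j, h⟩).1 + 1) ∧
        (∀ i, affForm c S y i = 0) ∧ ∀ j ∈ T.1, y j ≠ 0 ∧ y j ≠ 2 := by
    intro T u
    obtain ⟨y, hy1, hy2⟩ := exists_affForm_eq_zero c S T.1 T.2
      fun j => if h : j ∉ T.1 then Tev (u ⟨j, h⟩).1 + 1 else 0
    have hy1' : ∀ (j : Fin n) (h : j ∉ T.1), y j = Tev (u ⟨j, h⟩).1 + 1 := fun j h => by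
      rw [hy1 j h, dif_pos h]
    refine ⟨y, hy1', hy2, ?_⟩
    have hle := card_le_card_of_affForm_eq_zero c S y hy2
    -- Off `T` the values are `0` or `2`. Since at least `s` coordinates avoid these values, they
    -- are all those in `T`.
    have hsub : (Finset.univ.filter fun j : Fin n => y j ≠ 0 ∧ y j ≠ 2) ⊆ T.1 := by
      intro j hj
      by_contra hjT
      obtain ⟨_, h0, h2⟩ := Finset.mem_filter.mp hj
      have hv := hy1' j hjT
      rcases chebyshev_T_eval_of_critical hd (u ⟨j, hjT⟩).2 with h | h
      · exact h2 (by rw [hv, hTev]; simp only [h]; norm_num)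
      · exact h0 (by rw [hv, hTev]; simp only [h]; norm_num)
    have heq := Finset.eq_of_subset_of_card_le hsub (T.2.trans_le hle)
    intro j hj
    rw [← heq] at hj
    exact (Finset.mem_filter.mp hj).2
  choose Y hY1 hY2 hY3 using hY
  have hl : ∀ T : {T : Finset (Fin n) // T.card = S.card},
      ∃ l : S → L, ∀ j ∈ T.1, linForm c S σ (dehom l) j = 0 := fun T =>
    exists_linForm_eq_zero c S σ T.1 T.2
  choose l hl using hl
  set Conf : Type _ := Σ (T : {T : Finset (Fin n) // T.card = S.card})
    (u : {j : Fin n // j ∉ T.1} → Crit),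
    (j : {j : Fin n // j ∈ T.1}) → {x : L // (Polynomial.Chebyshev.T L d).eval x + 1 = Y T u j.1}
    with hConf
  have hcritcard : Nat.card Crit = d - 1 := natCard_critical hd
  set pt : Conf → Fin n → L := fun p j =>
    if h : j ∈ p.1.1 then (p.2.2 ⟨j, h⟩).1 else (p.2.1 ⟨j, h⟩).1 with hpt
  have hptY : ∀ p j, Tev (pt p j) + 1 = Y p.1 p.2.1 j := by
    intro p j
    by_cases hj : j ∈ p.1.1
    · simp only [hpt, dif_pos hj]
      exact (p.2.2 ⟨j, hj⟩).2
    · simp only [hpt, dif_neg hj]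
      exact (hY1 p.1 p.2.1 j hj).symm
  have hmem : ∀ p : Conf, (pt p, l p.1) ∈ affineZeros ρ d f g S σ := by
    intro p
    rw [mem_affineZeros_iff_of_map_X_eq_zero hρ]
    refine ⟨fun i => ?_, fun j => ?_⟩
    · have : (fun j => (Polynomial.Chebyshev.T L d).eval (pt p j) + 1) = Y p.1 p.2.1 :=
        funext fun j => hptY p j
      exact (congrArg (fun y => affForm c S y i) this).trans (hY2 p.1 p.2.1 i)
    · by_cases hj : j ∈ p.1.1
      · exact mul_eq_zero_of_left (hl p.1 j hj) _
      · refine mul_eq_zero_of_right _ ?_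
        simp only [hpt, dif_neg hj]
        exact (p.2.1 ⟨j, hj⟩).2
  have hbij : Function.Bijective
      (fun p : Conf => (⟨(pt p, l p.1), hmem p⟩ : affineZeros ρ d f g S σ)) := by
    constructor
    · intro p p' hpp
      have hx : pt p = pt p' := congrArg (fun z => z.1.1) hpp
      -- The set `T` can be recovered from `x` as the set of coordinates with `y_j ∉ {0, 2}`.
      have hTiff : ∀ (p : Conf) (j : Fin n), j ∈ p.1.1 ↔ Tev (pt p j) + 1 ≠ 0 ∧
          Tev (pt p j) + 1 ≠ 2 := by
        intro p j
        refine ⟨fun hj => ?_, fun h => ?_⟩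
        · rw [hptY]; exact hY3 p.1 p.2.1 j hj
        · by_contra hj
          have hv := hptY p j
          rw [hY1 p.1 p.2.1 j hj] at hv
          rcases chebyshev_T_eval_of_critical hd (p.2.1 ⟨j, hj⟩).2 with h' | h'
          · exact h.2 (by rw [hv, hTev]; simp only [h']; norm_num)
          · exact h.1 (by rw [hv, hTev]; simp only [h']; norm_num)
      have hT : p.1 = p'.1 := Subtype.ext (Finset.ext fun j => by rw [hTiff, hTiff, hx])
      obtain ⟨T, u, v⟩ := p
      obtain ⟨T', u', v'⟩ := p'
      obtain rfl : T = T' := hT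
      have hu : u = u' := by
        funext j
        have := congrFun hx j.1
        simp only [hpt, dif_neg j.2] at this
        exact Subtype.ext this
      subst hu
      have hv : v = v' := by
        funext j
        have := congrFun hx j.1
        simp only [hpt, dif_pos j.2] at this
        exact Subtype.ext this
      rw [hv]
    · rintro ⟨P, hP⟩
      obtain ⟨hcard, hst⟩ := initial_structure hρ hd hP
      have hP' := (mem_affineZeros_iff_of_map_X_eq_zero hρ).mp hP
      set T : {T : Finset (Fin n) // T.card = S.card} := ⟨_, hcard⟩ with hT
      have hTmem : ∀ j, j ∈ T.1 ↔ linForm c S σ (dehom P.2) j = 0 := fun j => by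
        simp only [hT, Finset.mem_filter, Finset.mem_univ, true_and, ← hc]
      set u : {j : Fin n // j ∉ T.1} → Crit := fun j => ⟨P.1 j.1, by
        by_contra h
        exact j.2 ((hTmem _).mpr ((hst _).mpr h))⟩ with hu
      have hYeq : (fun j => Tev (P.1 j) + 1) = Y T u :=
        affForm_unique c S T.1 T.2.le _ _ (fun j hj => by rw [hY1 T u j hj]) hP'.1 (hY2 T u)
      refine ⟨⟨T, u, fun j => ⟨P.1 j.1, congrFun hYeq j.1⟩⟩, Subtype.ext (Prod.ext ?_ ?_)⟩
      · funext j
        by_cases hj : j ∈ T.1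
        · simp only [hpt, dif_pos hj]
        · simp only [hpt, dif_neg hj, hu]
      · exact linForm_unique c S σ T.1 T.2 _ _ (hl T) fun j hj => (hTmem j).mp hj
  rw [← Nat.card_congr (Equiv.ofBijective _ hbij)]
  have hlev : ∀ (T : {T : Finset (Fin n) // T.card = S.card})
      (u : {j : Fin n // j ∉ T.1} → Crit) (j : {j : Fin n // j ∈ T.1}),
      Nat.card {x : L // (Polynomial.Chebyshev.T L d).eval x + 1 = Y T u j.1} = d := fun T u j =>
    natCard_level hd (hY3 T u j.1 j.2).1 (hY3 T u j.1 j.2).2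
  -- The cardinality `d - 1` can be zero here, and then `Nat.card` does not imply finiteness.
  have hcritfin : Finite Crit := by
    have h0 : Polynomial.derivative (Polynomial.Chebyshev.T L (d : ℤ)) ≠ 0 := by
      intro h
      have := Polynomial.derivative_eq_zero.mp h
      rw [natDegree_chebyshev_T] at this
      omega
    refine Set.Finite.to_subtype ((Polynomial.derivative
      (Polynomial.Chebyshev.T L (d : ℤ))).roots.toFinset.finite_toSet.subset fun x hx => ?_)
    have hx' : (Polynomial.derivative (Polynomial.Chebyshev.T L d)).eval x = 0 := hx
    simp [h0, hx']
  have hlevfin : ∀ (T : {T : Finset (Fin n) // T.card = S.card})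
      (u : {j : Fin n // j ∉ T.1} → Crit) (j : {j : Fin n // j ∈ T.1}),
      Finite {x : L // (Polynomial.Chebyshev.T L d).eval x + 1 = Y T u j.1} := fun T u j =>
    Nat.finite_of_card_ne_zero (by rw [hlev]; exact hd.ne')
  have := Fintype.ofFinite Crit
  rw [hConf, Nat.card_sigma]
  have hfib : ∀ T : {T : Finset (Fin n) // T.card = S.card},
      Nat.card (Σ (u : {j : Fin n // j ∉ T.1} → Crit), (j : {j : Fin n // j ∈ T.1}) →
        {x : L // (Polynomial.Chebyshev.T L d).eval x + 1 = Y T u j.1}) =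
      d ^ S.card * (d - 1) ^ (n - S.card) := by
    intro T
    rw [Nat.card_sigma]
    simp only [Nat.card_pi, hlev, Finset.prod_const, Finset.card_univ, Finset.sum_const,
      smul_eq_mul]
    rw [Fintype.card_coe, T.2, Fintype.card_fun, ← Nat.card_eq_fintype_card, hcritcard,
      Fintype.card_subtype_compl, Fintype.card_fin, Fintype.card_coe, T.2, mul_comm]
  simp only [hfib, Finset.sum_const, Finset.card_univ, smul_eq_mul, Fintype.card_finset_len,
    Fintype.card_fin]
  rw [bezoutNumber, mul_assoc]

end Counting

/-! ### Clearing denominators in values of polynomials. -/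

section Scaling

variable {R M : Type*} [CommRing R] [CommRing M]

/-- The value of a univariate polynomial of degree at most `D` at `z / u`, multiplied by `u ^ D`. -/
lemma exists_scaled_eval (h : R →+* M) (p : R[X]) {D : ℕ} (hp : p.natDegree ≤ D) {u z : R} {x : M}
    (hx : h u * x = h z) :
    ∃ w : R, h u ^ D * (p.map h).eval x = h (p.coeff D * z ^ D + u * w) := by
  -- The terms of degree `i < D` keep at least one factor `u`; with it removed they make up `w`.
  refine ⟨∑ i ∈ Finset.range D, p.coeff i * u ^ (D - 1 - i) * z ^ i, ?_⟩
  rw [Polynomial.eval_eq_sum_range' (n := D + 1)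
    (Nat.lt_succ_of_le (Polynomial.natDegree_map_le.trans hp)), Finset.sum_range_succ, mul_add,
    add_comm, map_add, Finset.mul_sum, Finset.mul_sum, map_sum]
  congr 1
  · rw [Polynomial.coeff_map, map_mul, map_pow, ← hx]
    ring
  · refine Finset.sum_congr rfl fun i hi => ?_
    have hi' := Finset.mem_range.mp hi
    have hD : D = 1 + (D - 1 - i) + i := by omega
    rw [Polynomial.coeff_map]
    conv_lhs => rw [hD]
    simp only [map_mul, map_pow, ← hx]
    ring

lemma scaled_monomial_mem_range {ι : Type*} [Fintype ι] (h : R →+* M) {D : ℕ} (α : ι →₀ ℕ)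
    (hα : ∑ i, α i ≤ D) {u : R} {z : ι → R} {x : ι → M} (hx : ∀ i, h u * x i = h (z i)) :
    h u ^ D * ∏ i, x i ^ α i ∈ h.range := by
  refine ⟨u ^ (D - ∑ i, α i) * ∏ i, z i ^ α i, ?_⟩
  have hD : D = (D - ∑ i, α i) + ∑ i, α i := by omega
  conv_rhs => rw [hD]
  simp only [map_mul, map_pow, map_prod, ← hx, pow_add, mul_pow, Finset.prod_mul_distrib,
    Finset.prod_pow_eq_pow_sum]
  ring

variable {K : Type*} [Field K]

lemma sum_le_of_mem_support {ι : Type*} [Fintype ι] {p : MvPolynomial ι K} {D : ℕ}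
    (hp : p.totalDegree ≤ D) {α : ι →₀ ℕ} (hα : α ∈ p.support) : ∑ i, α i ≤ D := by
  have := (MvPolynomial.le_totalDegree hα).trans hp
  rwa [Finsupp.sum_fintype _ _ fun _ => rfl] at this

lemma scaled_eval₂_mem_range {ι : Type*} [Fintype ι] (h : R →+* M) (c : K →+* R)
    (p : MvPolynomial ι K) {D : ℕ} (hp : p.totalDegree ≤ D) {u : R} {z : ι → R} {x : ι → M}
    (hx : ∀ i, h u * x i = h (z i)) :
    h u ^ D * MvPolynomial.eval₂ (h.comp c) x p ∈ h.range := by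
  rw [MvPolynomial.eval₂_eq', Finset.mul_sum]
  refine Subring.sum_mem _ fun α hα => ?_
  rw [mul_left_comm]
  exact Subring.mul_mem _ ⟨c _, rfl⟩
    (scaled_monomial_mem_range h α (sum_le_of_mem_support hp hα) hx)

/-- Each monomial loses one degree or disappears, so `u ^ (D - 1)` clears the denominators.
Integrality is all that is needed of these terms, because they occur multiplied by `t`. -/
lemma scaled_eval₂_pderiv_mem_range {ι : Type*} [Fintype ι] (h : R →+* M) (c : K →+* R)
    (p : MvPolynomial ι K) {D : ℕ} (hp : p.totalDegree ≤ D) (j : ι) {u : R} {z : ι → R}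
    {x : ι → M} (hx : ∀ i, h u * x i = h (z i)) :
    h u ^ (D - 1) * MvPolynomial.eval₂ (h.comp c) x (MvPolynomial.pderiv j p) ∈ h.range := by
  classical
  rw [← MvPolynomial.support_sum_monomial_coeff p, map_sum, MvPolynomial.eval₂_sum, Finset.mul_sum]
  refine Subring.sum_mem _ fun α hα => ?_
  rw [MvPolynomial.pderiv_monomial]
  rcases Nat.eq_zero_or_pos (α j) with h0 | h0
  · rw [h0, Nat.cast_zero, mul_zero, MvPolynomial.monomial_zero, MvPolynomial.eval₂_zero, mul_zero]
    exact Subring.zero_mem _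
  · have hsum : ∑ i, (α - Finsupp.single j 1 : ι →₀ ℕ) i + 1 = ∑ i, α i := by
      rw [← Finset.add_sum_erase _ _ (Finset.mem_univ j), ← Finset.add_sum_erase _ α
        (Finset.mem_univ j)]
      have : ∑ i ∈ Finset.univ.erase j, (α - Finsupp.single j 1 : ι →₀ ℕ) i =
          ∑ i ∈ Finset.univ.erase j, α i := by
        refine Finset.sum_congr rfl fun i hi => ?_
        rw [Finsupp.tsub_apply, Finsupp.single_eq_of_ne (Finset.ne_of_mem_erase hi), tsub_zero]
      rw [this, Finsupp.tsub_apply, Finsupp.single_eq_same]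
      omega
    have hle := sum_le_of_mem_support hp hα
    rw [MvPolynomial.eval₂_monomial, mul_left_comm, Finsupp.prod_fintype _ _ fun _ => pow_zero _]
    exact Subring.mul_mem _ ⟨c _, rfl⟩ (scaled_monomial_mem_range h _ (by omega) hx)

end Scaling

/-! ### No zeros at infinity and none with `λ₀ = 0` at `t = 0`. -/

section Infinity

variable {K : Type*} [Field K] {n m : ℕ}

lemma map_linForm {B B' : Type*} [CommRing B] [CommRing B'] (h : B →+* B') (c : K →+* B)
    (S : Finset (Fin m)) (σ : S → ℤˣ) (l : Option S → B) (j : Fin n) :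
    h (linForm c S σ l j) = linForm (h.comp c) S σ (fun o => h (l o)) j := by
  simp [linForm]

lemma linForm_mul {B : Type*} [CommRing B] (c : K →+* B) (S : Finset (Fin m)) (σ : S → ℤˣ)
    (r : B) (l : Option S → B) (j : Fin n) :
    linForm c S σ (fun o => r * l o) j = r * linForm c S σ l j := by
  simp only [linForm, mul_sub, Finset.mul_sum, mul_assoc]

lemma eval₂_G_mul {B : Type*} [CommRing B] (ρ : K[X] →+* B) (d : ℕ)
    (f : Fin m → MvPolynomial (Fin n) K) (g : MvPolynomial (Fin n) K) (S : Finset (Fin m))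
    (σ : S → ℤˣ) (j : Fin n) (x : Fin n → B) (r : B) (l : Option S → B) :
    MvPolynomial.eval₂ ρ (Sum.elim x fun o => r * l o) (G d f g S σ j) =
      r * MvPolynomial.eval₂ ρ (Sum.elim x l) (G d f g S σ j) := by
  rw [eval₂_G, eval₂_G, linForm_mul]
  simp only [mul_assoc, ← Finset.mul_sum]
  ring

lemma coeff_chebyshev_T {L : Type*} [Field L] [CharZero L] (d : ℕ) :
    (Polynomial.Chebyshev.T L d).coeff d = 2 ^ (d - 1) := by
  have := Polynomial.Chebyshev.leadingCoeff_T (R := L) d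
  rwa [Polynomial.leadingCoeff, natDegree_chebyshev_T, Int.natAbs_natCast] at this

/-- The deformed system has no zeros that go to infinity in the `x`-space at the point where
`t = 0`: here `z / u` are the coordinates of a zero and `u` is zero at that point. -/
lemma no_zero_at_infinity [CharZero K] {R M k : Type*} [CommRing R] [CommRing M] [Field k]
    [CharZero k] (h : R →+* M) (hh : Function.Injective h) (r : R →+* k) (ρ : K[X] →+* R)
    (hρ : r (ρ Polynomial.X) = 0) {d : ℕ} (hd : 0 < d) {f : Fin m → MvPolynomial (Fin n) K}
    (hf : ∀ i, (f i).totalDegree ≤ d) {g : MvPolynomial (Fin n) K} (hg : g.totalDegree ≤ d)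
    {S : Finset (Fin m)} {σ : S → ℤˣ} {u : R} (hu : r u = 0) {z : Fin n → R} {x : Fin n → M}
    (hx : ∀ j, h u * x j = h (z j)) {l : Option S → R}
    (hF : ∀ i, MvPolynomial.eval₂ (h.comp ρ) x (F d f S σ i) = 0)
    (hG : ∀ j, MvPolynomial.eval₂ (h.comp ρ) (Sum.elim x fun o => h (l o)) (G d f g S σ j) = 0)
    (hl : (fun o => r (l o)) ≠ 0) (hz : (fun j => r (z j)) ≠ 0) : False := by
  classical
  set c : K →+* R := ρ.comp Polynomial.C with hc
  have hcomp : (h.comp ρ).comp Polynomial.C = h.comp c := rfl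
  set p : R[X] := (Polynomial.Chebyshev.T K d).map c with hp
  have hpM : p.map h = Polynomial.Chebyshev.T M d := by
    rw [hp, Polynomial.map_map, Polynomial.Chebyshev.map_T]
  have hpdeg : p.natDegree ≤ d :=
    Polynomial.natDegree_map_le.trans (natDegree_chebyshev_T d).le
  have hpcoeff : p.coeff d = 2 ^ (d - 1) := by
    rw [hp, Polynomial.coeff_map, coeff_chebyshev_T, map_pow, map_ofNat]
  have hTw : ∀ j, ∃ w, h u ^ d * (Polynomial.Chebyshev.T M d).eval (x j) =
      h (2 ^ (d - 1) * z j ^ d + u * w) := by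
    intro j
    have := exists_scaled_eval h p hpdeg (hx j)
    rwa [hpM, hpcoeff] at this
  have hT'w : ∀ j, ∃ w, h u ^ (d - 1) *
      (Polynomial.derivative (Polynomial.Chebyshev.T M d)).eval (x j) =
      h (2 ^ (d - 1) * d * z j ^ (d - 1) + u * w) := by
    intro j
    have := exists_scaled_eval h (Polynomial.derivative p)
      ((Polynomial.natDegree_derivative_le p).trans (Nat.sub_le_sub_right hpdeg 1)) (hx j)
    rwa [← Polynomial.derivative_map, hpM, Polynomial.coeff_derivative, Nat.sub_add_cancel hd,
      hpcoeff, ← Nat.cast_succ, Nat.succ_eq_add_one, Nat.sub_add_cancel hd] at this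
  choose w hw using hTw
  choose w' hw' using hT'w
  -- Multiplied by `u ^ d` and reduced, `F_i` loses its part with `t` and all terms of lower degree.
  -- Only the leading form of `f̃_i` at `z` survives, up to the nonzero factor `σ_i 2^(d-1)`.
  have hF' : ∀ i : S, ∑ j : Fin n, (r.comp c) ((a n (i.val.val + 1) (j.val + 1) : ℚ) : K) *
      r (z j) ^ d = 0 := by
    intro i
    have h1 := hF i
    rw [eval₂_F, hcomp] at h1
    obtain ⟨v, hv⟩ := scaled_eval₂_mem_range h c (f i.val) (hf i.val) hx
    have h2 : h u ^ d * affForm (h.comp c) S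
        (fun j => (Polynomial.Chebyshev.T M d).eval (x j) + 1) i =
        h (u ^ d * c ((a n (i.val.val + 1) 0 : ℚ) : K) +
          ∑ j : Fin n, c ((a n (i.val.val + 1) (j.val + 1) : ℚ) : K) *
            (2 ^ (d - 1) * z j ^ d + u * w j + u ^ d)) := by
      rw [affForm, mul_add, Finset.mul_sum, map_add, map_sum]
      congr 1
      · simp
      · refine Finset.sum_congr rfl fun j _ => ?_
        rw [map_mul h, map_add h, ← hw j, map_pow, RingHom.comp_apply]
        ring
    have h3 : h (ρ Polynomial.X * v + (1 - ρ Polynomial.X) * (((σ i : ℤ) : R) *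
        (u ^ d * c ((a n (i.val.val + 1) 0 : ℚ) : K) +
          ∑ j : Fin n, c ((a n (i.val.val + 1) (j.val + 1) : ℚ) : K) *
            (2 ^ (d - 1) * z j ^ d + u * w j + u ^ d)))) = 0 := by
      rw [map_add, map_mul, map_mul, map_mul, hv, ← h2, map_sub, map_one, map_intCast]
      simp only [RingHom.comp_apply] at h1 ⊢
      linear_combination h u ^ d * h1
    rw [map_eq_zero_iff h hh] at h3
    have h4 := congrArg r h3
    simp only [map_add, map_mul, map_sub, map_one, hρ, zero_mul, zero_add, sub_zero, one_mul,
      map_pow, hu, zero_pow hd.ne', map_sum, map_zero, add_zero, map_intCast, map_ofNat] at h4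
    have h5 : ((σ i : ℤ) : k) ≠ 0 := by
      rcases Int.units_eq_one_or (σ i) with h | h <;> simp [h]
    have h6 := (mul_eq_zero.mp h4).resolve_left h5
    have h7 : (2 : k) ^ (d - 1) ≠ 0 := pow_ne_zero _ two_ne_zero
    refine (mul_eq_zero.mp ?_).resolve_left h7
    rw [← h6, Finset.mul_sum]
    exact Finset.sum_congr rfl fun j _ => by rw [RingHom.comp_apply]; ring
  -- Likewise `u ^ (d - 1) G_j` reduces to the linear form times `2^(d-1) d z_j^(d-1)`.
  have hG' : ∀ j, r (z j) ≠ 0 → linForm (r.comp c) S σ (fun o => r (l o)) j = 0 := by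
    intro j hzj
    have h1 := hG j
    rw [eval₂_G, hcomp, ← map_linForm] at h1
    obtain ⟨v₀, hv₀⟩ := scaled_eval₂_pderiv_mem_range h c g hg j hx
    have hvi : ∀ i : S, ∃ v, h v = h u ^ (d - 1) *
        MvPolynomial.eval₂ (h.comp c) x (MvPolynomial.pderiv j (f i.val)) := fun i =>
      scaled_eval₂_pderiv_mem_range h c (f i.val) (hf i.val) j hx
    choose v hv using hvi
    have h3 : h (ρ Polynomial.X * (l none * v₀ - ∑ i : S, l (some i) * v i) +
        (1 - ρ Polynomial.X) * (linForm c S σ l j *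
          (2 ^ (d - 1) * d * z j ^ (d - 1) + u * w' j))) = 0 := by
      rw [map_add, map_mul, map_mul, map_mul, ← hw' j, map_sub, map_mul, map_sum, hv₀, map_sub,
        map_one]
      simp only [map_mul h, hv]
      have h4 : ∑ i : S, h (l (some i)) * (h u ^ (d - 1) *
          MvPolynomial.eval₂ (h.comp c) x (MvPolynomial.pderiv j (f i.val))) =
          h u ^ (d - 1) * ∑ i : S, h (l (some i)) *
          MvPolynomial.eval₂ (h.comp c) x (MvPolynomial.pderiv j (f i.val)) := by
        rw [Finset.mul_sum]
        exact Finset.sum_congr rfl fun i _ => by ring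
      rw [h4]
      simp only [RingHom.comp_apply] at h1 ⊢
      linear_combination h u ^ (d - 1) * h1
    rw [map_eq_zero_iff h hh] at h3
    have h4 := congrArg r h3
    simp only [map_add, map_mul, map_sub, map_one, hρ, zero_mul, zero_add, sub_zero, one_mul,
      map_pow, hu, map_zero, add_zero, map_natCast, map_ofNat, map_linForm] at h4
    refine (mul_eq_zero.mp h4).resolve_right ?_
    exact mul_ne_zero (mul_ne_zero (pow_ne_zero _ two_ne_zero) (Nat.cast_ne_zero.mpr hd.ne'))
      (pow_ne_zero _ hzj)
  -- At most `s` reduced coordinates of `z` are nonzero, because each forces a form in `λ` to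
  -- vanish. The Cauchy equations for their `d`-th powers then make them zero as well.
  set T := Finset.univ.filter fun j : Fin n => r (z j) ≠ 0 with hT
  have hTcard : T.card ≤ S.card := by
    refine (Finset.card_le_card ?_).trans
      (card_linForm_eq_zero_le (n := n) (r.comp c) S σ (fun o => r (l o)) hl)
    intro j hj
    exact Finset.mem_filter.mpr ⟨Finset.mem_univ _, hG' j (Finset.mem_filter.mp hj).2⟩
  have h0 := eq_zero_of_columns (r.comp c) S T hTcard (fun j => r (z j) ^ d) fun i => by
    rw [← hF' i]
    refine Finset.sum_subset (Finset.subset_univ _) fun j _ hj => ?_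
    have : r (z j) = 0 := by
      by_contra h
      exact hj (Finset.mem_filter.mpr ⟨Finset.mem_univ _, h⟩)
    rw [this, zero_pow hd.ne', mul_zero]
  refine hz (funext fun j => ?_)
  by_contra hj
  exact hj (pow_eq_zero_iff hd.ne' |>.mp (h0 j (Finset.mem_filter.mpr ⟨Finset.mem_univ _, hj⟩)))

/-- At `t = 0`, the system has no zeros with `λ₀ = 0`. -/
lemma lambda_zero_ne_zero {k : Type*} [Field k] [CharZero k] (ρ : K[X] →+* k)
    (hρ : ρ Polynomial.X = 0) {d : ℕ} (hd : 0 < d) {f : Fin m → MvPolynomial (Fin n) K}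
    {g : MvPolynomial (Fin n) K} {S : Finset (Fin m)} {σ : S → ℤˣ} {x : Fin n → k}
    {l : Option S → k} (hF : ∀ i, MvPolynomial.eval₂ ρ x (F d f S σ i) = 0)
    (hG : ∀ j, MvPolynomial.eval₂ ρ (Sum.elim x l) (G d f g S σ j) = 0) (hl : l ≠ 0) :
    l none ≠ 0 := by
  classical
  intro h0
  have hF' : ∀ i, affForm (ρ.comp Polynomial.C) S
      (fun j => (Polynomial.Chebyshev.T k d).eval (x j) + 1) i = 0 := by
    intro i
    have := hF i
    rw [eval₂_F, hρ, zero_mul, zero_add, sub_zero, one_mul] at this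
    refine (mul_eq_zero.mp this).resolve_left ?_
    rcases Int.units_eq_one_or (σ i) with h | h <;> simp [h]
  have hcard := card_le_card_of_affForm_eq_zero _ S _ hF'
  -- At least `s` coordinates are noncritical, and their forms give `s` independent equations for
  -- the `s` unknowns left when `λ₀ = 0`.
  refine hl (eq_zero_of_rows (ρ.comp Polynomial.C) S σ (Finset.univ.erase none)
    (Finset.univ.filter fun j : Fin n => (Polynomial.Chebyshev.T k d).eval (x j) + 1 ≠ 0 ∧
      (Polynomial.Chebyshev.T k d).eval (x j) + 1 ≠ 2) ?_ l ?_ ?_)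
  · rwa [Finset.card_erase_of_mem (Finset.mem_univ _), Finset.card_univ,
      Fintype.card_option, Fintype.card_coe, Nat.add_sub_cancel]
  · rintro (_ | i) ho
    · exact h0
    · exact (ho (Finset.mem_erase.mpr ⟨Option.some_ne_none i, Finset.mem_univ _⟩)).elim
  · intro j hj
    obtain ⟨_, h1, h2⟩ := Finset.mem_filter.mp hj
    have := hG j
    rw [eval₂_G, hρ, zero_mul, zero_add, sub_zero, one_mul] at this
    refine (mul_eq_zero.mp this).resolve_right fun hcrit => ?_
    rcases chebyshev_T_eval_of_critical hd hcrit with h | h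
    · exact h2 (by rw [h]; norm_num)
    · exact h1 (by rw [h]; norm_num)

end Infinity

/-! ### Integrality of the zeros over a valued field. -/

section Valuation

/-- Divide by a coordinate of greatest valuation. The coordinate equal to `1` ensures that the
reduction of `w` is nonzero. -/
lemma exists_primitive_multiple {M ι : Type*} [Field M] [Finite ι] (V : ValuationSubring M)
    (v : ι → M) (hv : v ≠ 0) :
    ∃ (r : M) (w : ι → V), r ≠ 0 ∧ (∀ i, v i = r * (w i : M)) ∧ ∃ i, w i = 1 := by
  obtain ⟨i₁, hi₁⟩ := Function.ne_iff.mp hv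
  have : Nonempty ι := ⟨i₁⟩
  obtain ⟨i₀, hi₀⟩ := Finite.exists_max fun i => V.valuation (v i)
  have hne : v i₀ ≠ 0 := by
    intro h
    have := hi₀ i₁
    rw [h, map_zero] at this
    exact hi₁ ((map_eq_zero _).mp (le_antisymm this zero_le))
  refine ⟨v i₀, fun i => ⟨v i / v i₀, ?_⟩, hne, fun i => ?_, i₀, ?_⟩
  · rw [← V.valuation_le_one_iff, map_div₀]
    exact div_le_one_of_le₀ (hi₀ i) zero_le
  · rw [mul_div_cancel₀ _ hne]
  · exact Subtype.ext (div_self hne)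

variable {K : Type*} [Field K] [CharZero K] {n m : ℕ}

/-- A zero of the deformed system in `𝔸ⁿ × ℙˢ` over a valued field lies in `λ₀ ≠ 0` and has
integral coordinates, if `t` reduces to zero. -/
lemma exists_integral_zero {M : Type*} [Field M] (V : ValuationSubring M) (ρ : K[X] →+* V)
    (hρ : IsLocalRing.residue V (ρ Polynomial.X) = 0) {d : ℕ} (hd : 0 < d)
    {f : Fin m → MvPolynomial (Fin n) K} (hf : ∀ i, (f i).totalDegree ≤ d)
    {g : MvPolynomial (Fin n) K} (hg : g.totalDegree ≤ d) {S : Finset (Fin m)} {σ : S → ℤˣ}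
    {x : Fin n → M} {l : Option S → M}
    (hF : ∀ i, MvPolynomial.eval₂ (V.subtype.comp ρ) x (F d f S σ i) = 0)
    (hG : ∀ j, MvPolynomial.eval₂ (V.subtype.comp ρ) (Sum.elim x l) (G d f g S σ j) = 0)
    (hl : l ≠ 0) :
    l none ≠ 0 ∧ ∃ Q ∈ affineZeros ρ d f g S σ,
      mapPoint V.subtype Q = (x, fun i => l (some i) / l none) := by
  have hk : CharZero (IsLocalRing.ResidueField V) :=
    charZero_of_injective_ringHom
      (((IsLocalRing.residue V).comp ρ).comp Polynomial.C).injective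
  have hinj : Function.Injective V.subtype := Subtype.val_injective
  obtain ⟨r, w, hr, hw, o, ho⟩ := exists_primitive_multiple V l hl
  have hwl : l = fun o => r * V.subtype (w o) := funext hw
  have hwres : (fun o => IsLocalRing.residue V (w o)) ≠ 0 := by
    intro h
    have := congrFun h o
    simp only [ho, map_one, Pi.zero_apply] at this
    exact one_ne_zero this
  have hGw : ∀ j, MvPolynomial.eval₂ (V.subtype.comp ρ)
      (Sum.elim x fun o => V.subtype (w o)) (G d f g S σ j) = 0 := by
    intro j
    have := hG j
    rw [hwl, eval₂_G_mul] at this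
    exact (mul_eq_zero.mp this).resolve_left hr
  have hxV : ∀ j, x j ∈ V := by
    by_contra! hcon
    obtain ⟨j₀, hj₀⟩ := hcon
    obtain ⟨b, z, hb, hz, j₁, hj₁⟩ := exists_primitive_multiple V x fun h =>
      hj₀ (by rw [h]; exact V.zero_mem)
    have hbV : b ∉ V := fun hbV => hj₀ (by rw [hz j₀]; exact V.mul_mem _ _ hbV (z j₀).2)
    have hbinv : b⁻¹ ∈ V := (V.mem_or_inv_mem b).resolve_left hbV
    -- With `x = b z`, `z` primitive and `b` not integral, the element `u = b⁻¹` lies in the maximal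
    -- ideal and `u x = z`.
    refine no_zero_at_infinity V.subtype hinj (IsLocalRing.residue V) ρ hρ hd hf hg
      (u := ⟨b⁻¹, hbinv⟩) (z := z) (x := x) ?_ (fun j => ?_) hF hGw hwres ?_
    · rw [IsLocalRing.residue_eq_zero_iff, IsLocalRing.mem_maximalIdeal, mem_nonunits_iff]
      intro hunit
      obtain ⟨y, hy⟩ := hunit.exists_right_inv
      have hy' : b⁻¹ * (y : M) = 1 := congrArg Subtype.val hy
      have : b = y := by
        field_simp at hy'
        exact hy'.symm
      exact hbV (this ▸ y.2)
    · rw [hz j]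
      exact inv_mul_cancel_left₀ hb _
    · intro h
      have := congrFun h j₁
      simp only [hj₁, map_one, Pi.zero_apply] at this
      exact one_ne_zero this
  set X : Fin n → V := fun j => ⟨x j, hxV j⟩ with hX
  have hxX : x = V.subtype ∘ X := rfl
  have hFV : ∀ i, MvPolynomial.eval₂ ρ X (F d f S σ i) = 0 := by
    intro i
    have := hF i
    rwa [hxX, ← MvPolynomial.eval₂_comp_left, map_eq_zero_iff _ hinj] at this
  have hGV : ∀ j, MvPolynomial.eval₂ ρ (Sum.elim X w) (G d f g S σ j) = 0 := by
    intro j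
    have := hGw j
    rw [hxX, ← Function.comp_def V.subtype w, ← Sum.comp_elim, ← MvPolynomial.eval₂_comp_left,
      map_eq_zero_iff _ hinj] at this
    exact this
  have hw0res : IsLocalRing.residue V (w none) ≠ 0 := by
    refine lambda_zero_ne_zero ((IsLocalRing.residue V).comp ρ) hρ hd (f := f) (g := g) (S := S)
      (σ := σ) (x := fun j => IsLocalRing.residue V (X j))
      (l := fun o => IsLocalRing.residue V (w o)) (fun i => ?_) (fun j => ?_) hwres
    · have := congrArg (IsLocalRing.residue V) (hFV i)
      rwa [MvPolynomial.eval₂_comp_left, map_zero] at this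
    · have := congrArg (IsLocalRing.residue V) (hGV j)
      rwa [MvPolynomial.eval₂_comp_left, map_zero, Sum.comp_elim] at this
  have hunit : IsUnit (w none) := by
    by_contra h
    exact hw0res ((IsLocalRing.residue_eq_zero_iff _).mpr h)
  obtain ⟨y, hy⟩ := hunit.exists_right_inv
  have hw0 : (w none : M) ≠ 0 := fun h => hunit.ne_zero (Subtype.ext h)
  have hy' : (y : M) = (w none : M)⁻¹ := by
    have : (w none : M) * (y : M) = 1 := congrArg Subtype.val hy
    exact eq_inv_of_mul_eq_one_right this
  refine ⟨by rw [hw none]; exact mul_ne_zero hr hw0, (X, fun i => y * w (some i)),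
    ⟨hFV, fun j => ?_⟩, Prod.ext rfl (funext fun i => ?_)⟩
  · have h1 : dehom (fun i => y * w (some i)) = fun o => y * w o := by
      funext o
      rcases o with _ | i
      · simp only [dehom, Option.elim_none]
        rw [mul_comm, hy]
      · rfl
    rw [h1, eval₂_G_mul, hGV j, mul_zero]
  · change (y : M) * (w (some i) : M) = l (some i) / l none
    rw [hw (some i), hw none, hy']
    field_simp

end Valuation

/-! ### Unique lifting over local rings. -/

section Lifting

variable {K : Type*} [Field K] {n m : ℕ} {R k : Type*} [CommRing R] [Field k] [CharZero k]

lemma mapPoint_mapPoint {B B' B'' ι κ : Type*} [CommRing B] [CommRing B'] [CommRing B'']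
    (h : B →+* B') (h' : B' →+* B'') (P : (ι → B) × (κ → B)) :
    mapPoint h' (mapPoint h P) = mapPoint (h'.comp h) P := rfl

/-- The Jacobian determinant is a unit at a point that reduces to a zero at `t = 0`. -/
lemma isUnit_det_jacobian (h : R →+* k) [IsLocalHom h] (ρ : K[X] →+* R)
    (hρ : h (ρ Polynomial.X) = 0) {d : ℕ} (hd : 0 < d) {f : Fin m → MvPolynomial (Fin n) K}
    {g : MvPolynomial (Fin n) K} {S : Finset (Fin m)} {σ : S → ℤˣ} {P : (Fin n → R) × (S → R)}
    (hP : mapPoint h P ∈ affineZeros (h.comp ρ) d f g S σ) :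
    IsUnit (jacobian (fun e => MvPolynomial.map ρ (system d f g S σ e))
      (Sum.elim P.1 P.2)).det := by
  have hdet := det_jacobian_ne_zero (ρ := h.comp ρ) hρ hd hP
  refine isUnit_of_map_unit h _ ?_
  rw [RingHom.map_det]
  convert! hdet.isUnit using 2
  ext e i
  simp only [jacobian, RingHom.mapMatrix_apply, Matrix.map_apply, Matrix.of_apply,
    MvPolynomial.pderiv_map, MvPolynomial.eval_map]
  rw [MvPolynomial.eval₂_comp_left]
  congr 1
  funext e
  rcases e with j | i <;> rfl

/-- A zero of the deformed system over a local ring is determined by its reduction. -/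
lemma eq_of_mapPoint_eq [IsLocalRing R] (h : R →+* k) [IsLocalHom h] (ρ : K[X] →+* R)
    (hρ : h (ρ Polynomial.X) = 0) {d : ℕ} (hd : 0 < d) {f : Fin m → MvPolynomial (Fin n) K}
    {g : MvPolynomial (Fin n) K} {S : Finset (Fin m)} {σ : S → ℤˣ} {P Q : (Fin n → R) × (S → R)}
    (hP : P ∈ affineZeros ρ d f g S σ) (hQ : Q ∈ affineZeros ρ d f g S σ)
    (hPQ : mapPoint h P = mapPoint h Q) : P = Q := by
  have hmem : ∀ y z : R, h y = h z → z - y ∈ IsLocalRing.maximalIdeal R := by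
    intro y z hyz
    rw [IsLocalRing.mem_maximalIdeal, mem_nonunits_iff]
    intro hu
    have := hu.map h
    rw [map_sub, hyz, sub_self] at this
    exact not_isUnit_zero this
  have hz : ∀ P ∈ affineZeros ρ d f g S σ, ∀ e, MvPolynomial.eval (Sum.elim P.1 P.2)
      (MvPolynomial.map ρ (system d f g S σ e)) = 0 := fun P hP e => by
    rw [MvPolynomial.eval_map]
    exact (mem_affineZeros_iff ρ d f g S σ P).mp hP e
  have key := eq_of_isUnit_det_jacobian _ (Sum.elim P.1 P.2) (Sum.elim Q.1 Q.2) (hz P hP) (hz Q hQ)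
    (by
      rintro (j | i)
      · exact hmem _ _ (congrFun (congrArg Prod.fst hPQ) j)
      · exact hmem _ _ (congrFun (congrArg Prod.snd hPQ) i))
    (isUnit_det_jacobian h ρ hρ hd (mapPoint_mem_affineZeros h hP))
  exact Prod.ext (funext fun j => congrFun key (Sum.inl j))
    (funext fun i => congrFun key (Sum.inr i))

end Lifting

/-! ### Power series, Laurent series and the embedding of the closure of `K(t)`. -/

section Fields

variable (K : Type*) [Field K]

/-- The value of a power series at `t = 0`. -/
abbrev valueAtZero : Series K →+* AlgebraicClosure K := PowerSeries.constantCoeff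

instance : IsLocalHom (valueAtZero K) :=
  ⟨fun s hs => by
    rw [PowerSeries.isUnit_iff_constantCoeff]
    exact hs⟩

lemma toSeries_X : toSeries K Polynomial.X = PowerSeries.X := by
  simp [toSeries]

lemma toSeries_C (r : K) :
    toSeries K (Polynomial.C r) = PowerSeries.C (algebraMap K (AlgebraicClosure K) r) := by
  simp [toSeries]

lemma valueAtZero_toSeries_X : valueAtZero K (toSeries K Polynomial.X) = 0 := by
  rw [toSeries_X]
  exact PowerSeries.constantCoeff_X

lemma valueAtZero_comp_toSeries_comp_C :
    ((valueAtZero K).comp (toSeries K)).comp Polynomial.C = algebraMap K (AlgebraicClosure K) := by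
  ext r
  simp [toSeries_C]

lemma toSeries_injective : Function.Injective (toSeries K) := by
  exact (Polynomial.coe_injective (AlgebraicClosure K)).comp
    (Polynomial.map_injective _ (algebraMap K (AlgebraicClosure K)).injective)

lemma seriesToBig_injective : Function.Injective (seriesToBig K) :=
  (algebraMap (LaurentSeries (AlgebraicClosure K)) (BigField K)).injective.comp
    HahnSeries.ofPowerSeries_injective

/-- An embedding over `K[t]` of the algebraic closure of `K(t)` in the algebraic closure of the
field of Laurent series. -/
lemma exists_embedding : ∃ φ : Omega K →+* BigField K,
    φ.comp (toOmega K) = (seriesToBig K).comp (toSeries K) := by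
  set ψ : RatFunc K →+* BigField K :=
    IsFractionRing.lift (A := K[X]) (g := (seriesToBig K).comp (toSeries K))
      ((seriesToBig_injective K).comp (toSeries_injective K)) with hψ
  let := ψ.toAlgebra
  refine ⟨(IsAlgClosed.lift : Omega K →ₐ[RatFunc K] BigField K).toRingHom, ?_⟩
  refine RingHom.ext fun p => ?_
  change (IsAlgClosed.lift : Omega K →ₐ[RatFunc K] BigField K)
    (algebraMap (RatFunc K) (Omega K) (algebraMap K[X] (RatFunc K) p)) = _
  rw [AlgHom.commutes]
  exact IsFractionRing.lift_algebraMap _ _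

end Fields

/-! ### Zeros over the closure of the Laurent series field. -/

section Zeros

variable {K : Type*} [Field K] [CharZero K] {n m d : ℕ}

/-- Each zero at `t = 0` lifts to a zero over the power series ring. -/
lemma exists_series_lift (hd : 0 < d) (f : Fin m → MvPolynomial (Fin n) K)
    (g : MvPolynomial (Fin n) K) (S : Finset (Fin m)) (σ : S → ℤˣ)
    {p : (Fin n → AlgebraicClosure K) × (S → AlgebraicClosure K)}
    (hp : p ∈ affineZeros ((valueAtZero K).comp (toSeries K)) d f g S σ) :
    ∃ w ∈ affineZeros (toSeries K) d f g S σ, mapPoint (valueAtZero K) w = p := by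
  have : CharZero (AlgebraicClosure K) :=
    charZero_of_injective_algebraMap (algebraMap K (AlgebraicClosure K)).injective
  -- The constant series serve as the approximate zero in Hensel's lemma.
  set P : (Fin n → Series K) × (S → Series K) := mapPoint PowerSeries.C p with hPdef
  have hP : mapPoint (valueAtZero K) P = p := by
    refine Prod.ext (funext fun j => ?_) (funext fun i => ?_)
    · exact PowerSeries.constantCoeff_C _
    · exact PowerSeries.constantCoeff_C _
  have hmemI : ∀ s : Series K, s ∈ Ideal.span {(PowerSeries.X : Series K)} ↔
      valueAtZero K s = 0 := fun s => by
    rw [Ideal.mem_span_singleton, PowerSeries.X_dvd_iff]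
  obtain ⟨y, hy, hyP⟩ := exists_zero_of_isUnit_det_jacobian
    (Ideal.span {(PowerSeries.X : Series K)})
    (fun e => MvPolynomial.map (toSeries K) (system d f g S σ e)) (Sum.elim P.1 P.2)
    (fun e => by
      rw [hmemI, MvPolynomial.eval_map, ← eval₂_system_mapPoint, hP]
      exact (mem_affineZeros_iff _ d f g S σ p).mp hp e)
    (isUnit_det_jacobian (valueAtZero K) (toSeries K) (valueAtZero_toSeries_X K) hd
      (hP.symm ▸ hp))
  have hval : ∀ e, valueAtZero K (y e) = valueAtZero K (Sum.elim P.1 P.2 e) := fun e => by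
    have := (hmemI _).mp (hyP e)
    rwa [map_sub, sub_eq_zero] at this
  refine ⟨(fun j => y (Sum.inl j), fun i => y (Sum.inr i)), ?_, ?_⟩
  · rw [mem_affineZeros_iff]
    intro e
    have := hy e
    rw [MvPolynomial.eval_map] at this
    rw [← this]
    congr 1
    funext e
    rcases e with j | i <;> rfl
  · rw [← hP]
    exact Prod.ext (funext fun j => hval (Sum.inl j)) (funext fun i => hval (Sum.inr i))

/-- The zeros of the deformed system in `𝔸ⁿ × ℙˢ` over the algebraic closure of the field of
Laurent series come from the power series ring. -/
lemma exists_series_zero (hd : 0 < d) {f : Fin m → MvPolynomial (Fin n) K}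
    (hf : ∀ i, (f i).totalDegree ≤ d) {g : MvPolynomial (Fin n) K} (hg : g.totalDegree ≤ d)
    {S : Finset (Fin m)} {σ : S → ℤˣ}
    (hfin : (affineZeros ((valueAtZero K).comp (toSeries K)) d f g S σ).Finite)
    {x : Fin n → BigField K} {l : Option S → BigField K}
    (hF : ∀ i, MvPolynomial.eval₂ ((seriesToBig K).comp (toSeries K)) x (F d f S σ i) = 0)
    (hG : ∀ j, MvPolynomial.eval₂ ((seriesToBig K).comp (toSeries K)) (Sum.elim x l)
      (G d f g S σ j) = 0)
    (hl : l ≠ 0) :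
    l none ≠ 0 ∧ ∃ w ∈ affineZeros (toSeries K) d f g S σ,
      mapPoint (seriesToBig K) w = (x, fun i => l (some i) / l none) := by
  -- A valuation ring of the big field that dominates the power series ring. Domination makes `t`
  -- reduce to zero, so that reduction modulo its maximal ideal extends evaluation at `t = 0`.
  obtain ⟨V, hV, hloc⟩ := IsLocalRing.exists_factor_valuationRing (seriesToBig K)
  set χ : Series K →+* V := (seriesToBig K).codRestrict V.toSubring hV with hχ
  set res : Series K →+* IsLocalRing.ResidueField V := (IsLocalRing.residue V).comp χ with hres
  have hreszero : ∀ s, valueAtZero K s = 0 → res s = 0 := by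
    intro s hs
    rw [hres, RingHom.comp_apply, IsLocalRing.residue_eq_zero_iff, IsLocalRing.mem_maximalIdeal,
      mem_nonunits_iff]
    intro hu
    have := ((isUnit_of_map_unit χ s hu).map (valueAtZero K))
    rw [hs] at this
    exact not_isUnit_zero this
  set θ : AlgebraicClosure K →+* IsLocalRing.ResidueField V := res.comp PowerSeries.C with hθ
  have hresθ : res = θ.comp (valueAtZero K) := by
    refine RingHom.ext fun s => ?_
    rw [← sub_eq_zero]
    change res s - res (PowerSeries.C (valueAtZero K s)) = 0
    rw [← map_sub]
    refine hreszero _ ?_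
    rw [map_sub, sub_eq_zero]
    exact (PowerSeries.constantCoeff_C _).symm
  set ρ : K[X] →+* V := χ.comp (toSeries K) with hρdef
  have hρ : IsLocalRing.residue V (ρ Polynomial.X) = 0 :=
    hreszero _ (valueAtZero_toSeries_X K)
  obtain ⟨hl0, Q, hQ, hQeq⟩ := exists_integral_zero V ρ hρ hd hf hg hF hG hl
  refine ⟨hl0, ?_⟩
  have hQres := mapPoint_mem_affineZeros (IsLocalRing.residue V) hQ
  have hcomp : (IsLocalRing.residue V).comp ρ =
      θ.comp ((valueAtZero K).comp (toSeries K)) := by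
    rw [← RingHom.comp_assoc _ _ θ, ← hresθ]
    rfl
  rw [hcomp] at hQres
  -- The reduced point has coordinates in the residue field of `V`; finiteness of the initial zeros
  -- brings it down to the algebraic closure of `K`.
  obtain ⟨y, hy⟩ := exists_map_eq_of_finite_zeros θ
    (fun e => MvPolynomial.map ((valueAtZero K).comp (toSeries K)) (system d f g S σ e))
    (by
      refine (hfin.preimage (f := fun y : Fin n ⊕ S → AlgebraicClosure K =>
        (fun j => y (Sum.inl j), fun i => y (Sum.inr i))) ?_).subset ?_
      · intro y _ y' _ hyy
        funext e
        rcases e with j | i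
        · exact congrFun (congrArg Prod.fst hyy) j
        · exact congrFun (congrArg Prod.snd hyy) i
      · intro y hy
        refine (mem_affineZeros_iff _ d f g S σ _).mpr fun e => ?_
        have := hy e
        rw [MvPolynomial.eval_map] at this
        rw [← this]
        congr 1
        funext e
        rcases e with j | i <;> rfl)
    (Sum.elim (mapPoint (IsLocalRing.residue V) Q).1 (mapPoint (IsLocalRing.residue V) Q).2)
    (fun e => by
      rw [MvPolynomial.eval₂_map]
      exact (mem_affineZeros_iff _ d f g S σ _).mp hQres e)
  set p : (Fin n → AlgebraicClosure K) × (S → AlgebraicClosure K) :=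
    (fun j => y (Sum.inl j), fun i => y (Sum.inr i)) with hp
  have hpQ : mapPoint θ p = mapPoint (IsLocalRing.residue V) Q :=
    Prod.ext (funext fun j => hy (Sum.inl j)) (funext fun i => hy (Sum.inr i))
  rw [← hpQ, mapPoint_mem_affineZeros_iff θ θ.injective] at hQres
  obtain ⟨w, hw, hwp⟩ := exists_series_lift hd f g S σ hQres
  have hk : CharZero (IsLocalRing.ResidueField V) :=
    charZero_of_injective_ringHom
      (((IsLocalRing.residue V).comp ρ).comp Polynomial.C).injective
  -- Both points are zeros over the local ring `V` with the same reduction.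
  have hwQ : mapPoint χ w = Q := by
    refine eq_of_mapPoint_eq (IsLocalRing.residue V) ρ hρ hd (mapPoint_mem_affineZeros χ hw) hQ ?_
    rw [← hpQ, ← hwp, mapPoint_mapPoint, mapPoint_mapPoint, ← hresθ]
  refine ⟨w, hw, ?_⟩
  rw [← hQeq, ← hwQ]
  rfl

end Zeros

/-! ### Enumeration of the zeros and descent to the closure of `K(t)`. -/

section Enumeration

variable {K : Type*} [Field K] [CharZero K] {n m d : ℕ}

lemma bezoutNumber_ne_zero {n d s : ℕ} (hd : 1 < d) (hs : s ≤ n) : bezoutNumber n d s ≠ 0 :=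
  mul_ne_zero (mul_ne_zero (Nat.choose_pos hs).ne' (pow_ne_zero _ (by omega)))
    (pow_ne_zero _ (by omega))

/-- The zeros over the power series ring are enumerated by the zeros at `t = 0`. -/
lemma exists_enumeration (hd : 1 < d) (f : Fin m → MvPolynomial (Fin n) K)
    (g : MvPolynomial (Fin n) K) (S : Finset (Fin m)) (hS : S.card ≤ n) (σ : S → ℤˣ) :
    ∃ Ws : Fin (bezoutNumber n d S.card) → (Fin n → Series K) × (S → Series K),
      Set.range Ws = affineZeros (toSeries K) d f g S σ ∧
      Function.Injective (fun k => mapPoint (valueAtZero K) (Ws k)) ∧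
      Set.range (fun k => mapPoint (valueAtZero K) (Ws k)) =
        affineZeros ((valueAtZero K).comp (toSeries K)) d f g S σ := by
  have : CharZero (AlgebraicClosure K) :=
    charZero_of_injective_algebraMap (algebraMap K (AlgebraicClosure K)).injective
  have hd0 : 0 < d := by omega
  have hcard := natCard_affineZeros_initial (ρ := (valueAtZero K).comp (toSeries K))
    (valueAtZero_toSeries_X K) hd0 f g S σ
  have hfin : Finite (affineZeros ((valueAtZero K).comp (toSeries K)) d f g S σ) :=
    Nat.finite_of_card_ne_zero (by rw [hcard]; exact bezoutNumber_ne_zero hd hS)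
  set e := (Finite.equivFinOfCardEq hcard).symm
  choose Ws hWs hWs0 using fun k => exists_series_lift hd0 f g S σ (e k).2
  refine ⟨Ws, ?_, ?_, ?_⟩
  · ext P
    constructor
    · rintro ⟨k, rfl⟩
      exact hWs k
    · intro hP
      obtain ⟨k, hk⟩ := e.surjective ⟨_, mapPoint_mem_affineZeros (valueAtZero K) hP⟩
      refine ⟨k, eq_of_mapPoint_eq (valueAtZero K) (toSeries K) (valueAtZero_toSeries_X K) hd0
        (hWs k) hP ?_⟩
      rw [hWs0, hk]
  · intro k k' hkk
    simp only [hWs0] at hkk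
    exact e.injective (Subtype.ext hkk)
  · simp only [hWs0]
    ext p
    constructor
    · rintro ⟨k, rfl⟩
      exact (e k).2
    · intro hp
      obtain ⟨k, hk⟩ := e.surjective ⟨p, hp⟩
      exact ⟨k, congrArg Subtype.val hk⟩

/-- The zeros over the power series ring are defined over the algebraic closure of `K(t)`. -/
lemma exists_omega_zero (hd : 1 < d) {f : Fin m → MvPolynomial (Fin n) K}
    (hf : ∀ i, (f i).totalDegree ≤ d) {g : MvPolynomial (Fin n) K} (hg : g.totalDegree ≤ d)
    {S : Finset (Fin m)} (hS : S.card ≤ n) {σ : S → ℤˣ} (φ : Omega K →+* BigField K)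
    (hφ : φ.comp (toOmega K) = (seriesToBig K).comp (toSeries K))
    {w : (Fin n → Series K) × (S → Series K)} (hw : w ∈ affineZeros (toSeries K) d f g S σ) :
    ∃ P ∈ affineZeros (toOmega K) d f g S σ, mapPoint φ P = mapPoint (seriesToBig K) w := by
  obtain ⟨Ws, hWs, _, hWs0⟩ := exists_enumeration hd f g S hS σ
  have hfin0 : (affineZeros ((valueAtZero K).comp (toSeries K)) d f g S σ).Finite := by
    rw [← hWs0]; exact Set.finite_range _
  have hfins : (affineZeros (toSeries K) d f g S σ).Finite := by
    rw [← hWs]; exact Set.finite_range _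
  -- `φ` embeds these zeros in the images of the finitely many power series zeros; finiteness then
  -- allows the descent of the latter.
  have hfin : (affineZeros (toOmega K) d f g S σ).Finite := by
    refine ((hfins.image (mapPoint (seriesToBig K))).preimage
      (mapPoint_injective φ φ.injective).injOn).subset fun P hP => ?_
    have hP' := mapPoint_mem_affineZeros φ hP
    rw [hφ] at hP'
    obtain ⟨_, v, hv, hveq⟩ := exists_series_zero (by omega) hf hg hfin0 hP'.1 hP'.2
      (dehom_ne_zero _)
    refine ⟨v, hv, hveq.trans (Prod.ext rfl (funext fun i => ?_))⟩
    simp [dehom]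
  have hwB := mapPoint_mem_affineZeros (seriesToBig K) hw
  obtain ⟨y, hy⟩ := exists_map_eq_of_finite_zeros φ
    (fun e => MvPolynomial.map (toOmega K) (system d f g S σ e))
    (by
      refine (hfin.preimage (f := fun y : Fin n ⊕ S → Omega K =>
        (fun j => y (Sum.inl j), fun i => y (Sum.inr i))) ?_).subset ?_
      · intro y _ y' _ hyy
        funext e
        rcases e with j | i
        · exact congrFun (congrArg Prod.fst hyy) j
        · exact congrFun (congrArg Prod.snd hyy) i
      · intro y hy
        refine (mem_affineZeros_iff _ d f g S σ _).mpr fun e => ?_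
        have := hy e
        rw [MvPolynomial.eval_map] at this
        rw [← this]
        congr 1
        funext e
        rcases e with j | i <;> rfl)
    (Sum.elim (mapPoint (seriesToBig K) w).1 (mapPoint (seriesToBig K) w).2)
    (fun e => by
      rw [MvPolynomial.eval₂_map, hφ]
      exact (mem_affineZeros_iff _ d f g S σ _).mp hwB e)
  have hPeq : mapPoint φ (fun j => y (Sum.inl j), fun i => y (Sum.inr i)) =
      mapPoint (seriesToBig K) w :=
    Prod.ext (funext fun j => hy (Sum.inl j)) (funext fun i => hy (Sum.inr i))
  refine ⟨_, ?_, hPeq⟩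
  rw [← mapPoint_mem_affineZeros_iff φ φ.injective, hPeq, hφ]
  exact hwB

/-- The point of `𝔸ⁿ × ℙˢ` with the homogeneous coordinates `λ₀ = 1` and `λ_i`. -/
def toProjective {Ω : Type*} [Field Ω] {S : Finset (Fin m)} (P : (Fin n → Ω) × (S → Ω)) :
    (Fin n → Ω) × Projectivization Ω (Option S → Ω) :=
  (P.1, Projectivization.mk Ω (dehom P.2) (dehom_ne_zero P.2))

/-- The representative chosen by `rep` need not be the one with `λ₀ = 1`, but differs from it by a
nonzero scalar. -/
lemma exists_rep_toProjective {Ω : Type*} [Field Ω] {S : Finset (Fin m)}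
    (P : (Fin n → Ω) × (S → Ω)) :
    ∃ r : Ω, r ≠ 0 ∧ (toProjective P).2.rep = fun o => r * dehom P.2 o := by
  obtain ⟨u, hu⟩ := Projectivization.exists_smul_eq_mk_rep Ω (dehom P.2) (dehom_ne_zero P.2)
  exact ⟨u, u.ne_zero, hu.symm⟩

end Enumeration

end Deformation

end

/-! ### The main theorem. -/

theorem mainTheorem6 {K : Type*} [Field K] [CharZero K] (n m d : ℕ) (hn : 1 ≤ n)
    (hd : Even d) (hd0 : 0 < d)
    (f : Fin m → MvPolynomial (Fin n) K) (hf : ∀ i, (f i).totalDegree ≤ d)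
    (g : MvPolynomial (Fin n) K) (hg : g.totalDegree ≤ d)
    (S : Finset (Fin m)) (hS : S.card ≤ n) (σ : S → ℤˣ) :
    ∃ (W : Fin (Deformation.bezoutNumber n d S.card) →
        (Fin n → Deformation.Omega K) ×
          Projectivization (Deformation.Omega K) (Option S → Deformation.Omega K))
      (Ws : Fin (Deformation.bezoutNumber n d S.card) →
        (Fin n → Deformation.Series K) × (S → Deformation.Series K))
      (φ : Deformation.Omega K →+* Deformation.BigField K),
      -- the variety is the finite set of the `D_s` distinct points `W k`
      Set.range W =
        Deformation.variety (Deformation.Omega K) (Deformation.toOmega K) d f g S σ ∧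
      Function.Injective W ∧
      -- the points lie in `λ₀ ≠ 0`, and their projections to the `x`-space are distinct
      (∀ k, (W k).2.rep none ≠ 0) ∧
      Function.Injective (fun k => (W k).1) ∧
      -- `φ` is an embedding over `K[t]`, and it identifies `W k` with a power series point
      (∀ c, φ (Deformation.toOmega K c) =
        Deformation.seriesToBig K (Deformation.toSeries K c)) ∧
      (∀ k j, φ ((W k).1 j) = Deformation.seriesToBig K ((Ws k).1 j)) ∧
      (∀ k i, φ ((W k).2.rep (some i) / (W k).2.rep none) =
        Deformation.seriesToBig K ((Ws k).2 i)) ∧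
      -- the power series points are the zeros of the deformed system over the power series ring,
      -- and each zero of the system at `t = 0` lifts to exactly one of them
      Set.range Ws = Deformation.affineZeros (Deformation.toSeries K) d f g S σ ∧
      Function.Injective (fun k => Deformation.atZero K (Ws k)) ∧
      Set.range (fun k => Deformation.atZero K (Ws k)) =
        Deformation.initialZeros (K := K) (AlgebraicClosure K) n d S σ := by
  -- For `d ≥ 2` the number `D_s` is nonzero, so the `Nat.card` count of the initial zeros also
  -- yields their finiteness.
  have hd1 : 1 < d := by
    obtain ⟨r, hr⟩ := hd
    omega
  obtain ⟨φ, hφ⟩ := Deformation.exists_embedding K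
  obtain ⟨Ws, hWs, hinj0, hWs0⟩ := Deformation.exists_enumeration hd1 f g S hS σ
  have : CharZero (AlgebraicClosure K) :=
    charZero_of_injective_algebraMap (algebraMap K (AlgebraicClosure K)).injective
  have hmem : ∀ k, Ws k ∈ Deformation.affineZeros (Deformation.toSeries K) d f g S σ :=
    fun k => hWs ▸ Set.mem_range_self k
  choose P hP hPφ using fun k =>
    Deformation.exists_omega_zero hd1 hf hg hS φ hφ (hmem k)
  choose r hr hrep using fun k => Deformation.exists_rep_toProjective (P k)
  -- If two projections agree, so do their values at `t = 0`, and an initial zero is determined by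
  -- its `x`-part.
  have hfst : Function.Injective fun k => (P k).1 := by
    intro k k' hkk
    refine hinj0 (Deformation.initial_fst_injective
      (ρ := (Deformation.valueAtZero K).comp (Deformation.toSeries K))
      (Deformation.valueAtZero_toSeries_X K) hd0 (hWs0 ▸ Set.mem_range_self k)
      (hWs0 ▸ Set.mem_range_self k') (funext fun j => ?_))
    refine congrArg (Deformation.valueAtZero K) (a₁ := (Ws k).1 j) (a₂ := (Ws k').1 j)
      (Deformation.seriesToBig_injective K ?_)
    have h1 := congrFun (congrArg Prod.fst (hPφ k)) j
    have h2 := congrFun (congrArg Prod.fst (hPφ k')) j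
    exact h1.symm.trans ((congrArg φ (congrFun hkk j)).trans h2)
  refine ⟨fun k => Deformation.toProjective (P k), Ws, φ, ?_, fun k k' hkk => by
    have h := congrArg Prod.fst hkk
    exact hfst h, fun k => ?_, hfst, fun c => RingHom.congr_fun hφ c,
    fun k j => congrFun (congrArg Prod.fst (hPφ k)) j, fun k i => ?_, hWs, hinj0, ?_⟩
  · ext ⟨x, l⟩
    constructor
    · rintro ⟨k, hk⟩
      rw [← hk]
      refine ⟨(hP k).1, fun j => ?_⟩
      rw [hrep, Deformation.eval₂_G_mul]
      exact mul_eq_zero_of_right _ ((hP k).2 j)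
    · rintro ⟨hF, hG⟩
      have hne : (fun o => φ (l.rep o)) ≠ 0 := fun h => l.rep_nonzero
        (funext fun o => (map_eq_zero φ).mp (congrFun h o))
      -- The image under `φ` of any point of the variety is a power series zero, hence one of the
      -- `Ws k`; injectivity of `φ` then identifies the point with `W k`.
      obtain ⟨hl0, w, hw, hwx⟩ := Deformation.exists_series_zero hd0 hf hg (σ := σ)
        (hWs0 ▸ Set.finite_range _) (x := fun j => φ (x j)) (l := fun o => φ (l.rep o))
        (fun i => by
          have := congrArg φ (hF i)
          rwa [MvPolynomial.eval₂_comp_left, map_zero, hφ] at this)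
        (fun j => by
          have := congrArg φ (hG j)
          rwa [MvPolynomial.eval₂_comp_left, map_zero, hφ, Sum.comp_elim] at this) hne
      rw [← hWs] at hw
      obtain ⟨k, rfl⟩ := hw
      have hl0' : l.rep none ≠ 0 := fun h => hl0 (by simp only [h, map_zero])
      rw [← hPφ k] at hwx
      refine ⟨k, Prod.ext (funext fun j => φ.injective (congrFun (congrArg Prod.fst hwx) j)) ?_⟩
      change Projectivization.mk _ _ _ = l
      rw [← l.mk_rep, Projectivization.mk_eq_mk_iff']
      refine ⟨(l.rep none)⁻¹, funext fun o => ?_⟩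
      rcases o with _ | i
      · exact inv_mul_cancel₀ hl0'
      · refine φ.injective ?_
        have h1 := congrFun (congrArg Prod.snd hwx) i
        refine Eq.trans ?_ h1.symm
        simp only [Pi.smul_apply, smul_eq_mul, map_mul, map_inv₀]
        rw [div_eq_inv_mul]
  · rw [hrep]
    exact mul_ne_zero (hr k) one_ne_zero
  · rw [hrep]
    have h1 := congrFun (congrArg Prod.snd (hPφ k)) i
    refine Eq.trans (congrArg φ ?_) h1
    simp only [Deformation.dehom, Option.elim_none, Option.elim_some, mul_one]
    exact mul_div_cancel_left₀ _ (hr k)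
  · rw [Deformation.initialZeros_eq (AlgebraicClosure K)
      (ρ := (Deformation.valueAtZero K).comp (Deformation.toSeries K))
      (Deformation.valueAtZero_toSeries_X K) (Deformation.valueAtZero_comp_toSeries_comp_C K)
      d f g S σ]
    exact hWs0
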